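/- All graphs are finite multigraphs. For $r\ge 1$ let $\theta_r$ be the graph with two vertices and $r$ parallel edges between them. Contracting an edge removes it and identifies its two ends, all other edges (in particular parallel ones) being kept; contracting a loop removes it. A *model* of $\theta_r$ in a graph $G$ is a subgraph of $G$ that can be turned into a graph isomorphic to $\theta_r$ by a sequence of edge contractions. Let $\mathrm{pack}_r(G)$ and $\mathrm{epack}_r(G)$ be the maximum number of pairwise vertex-disjoint, respectively pairwise edge-disjoint, models of $\theta_r$ in $G$. Let $\mathrm{cover}_r(G)$ be the minimum size of a set of vertices of $G$ meeting the vertex set of every model of $\theta_r$ in $G$, and $\mathrm{ecover}_r(G)$ the minimum size of a set of edges of $G$ meeting the edge set of every such model. A function $f\colon\mathbb N\to\mathbb N$ is a *vertex-Erdős–Pósa gap* of $\theta_r$ if $\mathrm{cover}_r(G)\le f(\mathrm{pack}_r(G))$ for every graph $G$, and an *edge-Erdős–Pósa gap* of $\theta_r$ if $\mathrm{ecover}_r(G)\le f(\mathrm{epack}_r(G))$ for every graph $G$. **Corollary.** For every $r\ge 1$ the graph $\theta_r$ has a vertex-Erdős–Pósa gap $f_r(k)=O(k^2r^2)$ and an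 edge-Erdős–Pósa gap $g_r(k)=O(k^3r^3)$, with absolute implied constants. That is, there is a constant $C$ such that for all integers $r\ge1$ and $k\ge0$ one has $f_r(k)\le C\,k^2r^2$ and $g_r(k)\le C\,k^3r^3$. -/

import Mathlib

/-! Finite multigraphs are Mathlib's `Graph α β` (loops and parallel edges allowed) with finite
vertex and edge sets; `H ≤ G` is the subgraph relation. -/

universe u v u' v'

namespace ErdosPosa

/-- Two multigraphs are isomorphic: bijections of the vertex sets and of the edge sets that
preserve the ends of every edge. -/
def Isomorphic {α : Type u} {β : Type v} {α' : Type u'} {β' : Type v'}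
    (G : Graph α β) (G' : Graph α' β') : Prop :=
  ∃ (φ : G.vertexSet ≃ G'.vertexSet) (ψ : G.edgeSet ≃ G'.edgeSet),
    ∀ (e : G.edgeSet) (x y : G.vertexSet),
      G.IsLink (e : β) (x : α) (y : α) ↔ G'.IsLink (ψ e : β') (φ x : α') (φ y : α')

open Classical in
/-- Remove the edge `e` and identify the vertex `y` with the vertex `x`. All other edges are kept,
so parallel edges may appear. This is meant for an edge `e` with ends `x` and `y`; if `x = y`
it just removes the loop `e`. -/
noncomputable def contractEdge {α : Type u} {β : Type v} (G : Graph α β) (e : β) (x y : α) :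
    Graph α β :=
  (G.deleteEdges {e}).map (fun z => if z = y then x else z)

/-- `G'` arises from `G` by the contraction of one edge. -/
def ContractionStep {α : Type u} {β : Type v} (G G' : Graph α β) : Prop :=
  ∃ (e : β) (x y : α), G.IsLink e x y ∧ G' = contractEdge G e x y

/-- `H` belongs to `𝓜(J)`: it can be contracted to (an isomorphic copy of) `J` by a
finite, possibly empty, sequence of edge contractions. -/
def IsModel {α : Type u} {β : Type v} {α' : Type u'} {β' : Type v'}
    (J : Graph α' β') (H : Graph α β) : Prop :=
  ∃ K : Graph α β, Relation.ReflTransGen ContractionStep H K ∧ Isomorphic K J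

/-- `G` contains `k` pairwise vertex-disjoint models of `J`. -/
def HasVertexPacking {α : Type u} {β : Type v} {α' : Type u'} {β' : Type v'}
    (J : Graph α' β') (G : Graph α β) (k : ℕ) : Prop :=
  ∃ H : Fin k → Graph α β, (∀ i, H i ≤ G ∧ IsModel J (H i)) ∧
    ∀ i j, i ≠ j → Disjoint (H i).vertexSet (H j).vertexSet

/-- `G` contains `k` pairwise edge-disjoint models of `J`. -/
def HasEdgePacking {α : Type u} {β : Type v} {α' : Type u'} {β' : Type v'}
    (J : Graph α' β') (G : Graph α β) (k : ℕ) : Prop :=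
  ∃ H : Fin k → Graph α β, (∀ i, H i ≤ G ∧ IsModel J (H i)) ∧
    ∀ i j, i ≠ j → Disjoint (H i).edgeSet (H j).edgeSet

/-- A set of vertices of `G` meeting the vertex sets of all models of `J` in `G`. -/
def IsVertexHittingSet {α : Type u} {β : Type v} {α' : Type u'} {β' : Type v'}
    (J : Graph α' β') (G : Graph α β) (S : Set α) : Prop :=
  S ⊆ G.vertexSet ∧ ∀ H : Graph α β, H ≤ G → IsModel J H → (H.vertexSet ∩ S).Nonempty

/-- A set of edges of `G` meeting the edge sets of all models of `J` in `G`. -/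
def IsEdgeHittingSet {α : Type u} {β : Type v} {α' : Type u'} {β' : Type v'}
    (J : Graph α' β') (G : Graph α β) (S : Set β) : Prop :=
  S ⊆ G.edgeSet ∧ ∀ H : Graph α β, H ≤ G → IsModel J H → (H.edgeSet ∩ S).Nonempty

/-- The maximum number of vertex-disjoint models of `J` in `G`. -/
noncomputable def vertexPack {α : Type u} {β : Type v} {α' : Type u'} {β' : Type v'}
    (J : Graph α' β') (G : Graph α β) : ℕ∞ :=
  ⨆ (k : ℕ) (_ : HasVertexPacking J G k), (k : ℕ∞)

/-- The minimum size of a vertex-hitting set for the models of `J` in `G`. -/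
noncomputable def vertexCover {α : Type u} {β : Type v} {α' : Type u'} {β' : Type v'}
    (J : Graph α' β') (G : Graph α β) : ℕ∞ :=
  ⨅ (S : Set α) (_ : IsVertexHittingSet J G S), S.encard

/-- The maximum number of edge-disjoint models of `J` in `G`. -/
noncomputable def edgePack {α : Type u} {β : Type v} {α' : Type u'} {β' : Type v'}
    (J : Graph α' β') (G : Graph α β) : ℕ∞ :=
  ⨆ (k : ℕ) (_ : HasEdgePacking J G k), (k : ℕ∞)

/-- The minimum size of an edge-hitting set for the models of `J` in `G`. -/
noncomputable def edgeCover {α : Type u} {β : Type v} {α' : Type u'} {β' : Type v'}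
    (J : Graph α' β') (G : Graph α β) : ℕ∞ :=
  ⨅ (S : Set β) (_ : IsEdgeHittingSet J G S), S.encard

/-- `f` is a vertex-Erdős–Pósa gap of `J`: in every finite multigraph `G` the maximum packing is
finite and `vertexCover J G ≤ f (vertexPack J G)`. -/
def IsVertexGap {α' : Type u'} {β' : Type v'} (J : Graph α' β') (f : ℕ → ℕ) : Prop :=
  ∀ (α : Type u) (β : Type v) (G : Graph α β), G.vertexSet.Finite → G.edgeSet.Finite →
    ∃ k : ℕ, vertexPack J G = (k : ℕ∞) ∧ vertexCover J G ≤ (f k : ℕ∞)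

/-- `f` is an edge-Erdős–Pósa gap of `J`: in every finite multigraph `G` the maximum packing is
finite and `edgeCover J G ≤ f (edgePack J G)`. -/
def IsEdgeGap {α' : Type u'} {β' : Type v'} (J : Graph α' β') (f : ℕ → ℕ) : Prop :=
  ∀ (α : Type u) (β : Type v) (G : Graph α β), G.vertexSet.Finite → G.edgeSet.Finite →
    ∃ k : ℕ, edgePack J G = (k : ℕ∞) ∧ edgeCover J G ≤ (f k : ℕ∞)

/-- The multigraph `θ_r` with two vertices and `r` parallel edges between them. -/
def theta (r : ℕ) : Graph (Fin 2) (Fin r) :=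
  Graph.banana 0 1 Set.univ

end ErdosPosa

/-! Erdős–Pósa gaps of the multigraphs `theta r`: brambles of large order contain many disjoint models
(via Menger's theorem), and a cut of bounded size splits a graph of bounded packing number. -/

/-! A model of θ_r amounts to two disjoint connected vertex sets with at least `r` edges between
them (`Theta`). Such a pair pulls back along a contraction (`Theta.of_contractEdge`); conversely,
after discarding surplus edges, everything inside the two sets can be contracted
(`ThetaPartition.isModel`). Both problems thus become packing and hitting problems for families of
sets, `vertexModels` and `edgeModels`.

The engine is a bramble theorem, `exists_disjoint_theta`. Suppose pairwise intersecting connected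
sets cannot all be hit by fewer than `2 * K^2 * r` vertices. A single path meets all of them; cut at
the right place, it yields two subpaths joined, by `menger`, by `K^2 * r` disjoint connections.
Selecting connections by their position on the first subpath, then on the second, leaves `K` groups
of `r` connections that span disjoint intervals on both sides: `K` disjoint models.

Now let there be no `k + 1` disjoint models. Connected sets that each pack more than `k / 2` models
pairwise intersect, since two disjoint ones would together pack `k + 1`. By the engine with `K = k +
1`, fewer than `2 * (k + 1)^2 * r` vertices `Y` meet them all. For vertices, deleting `Y` leaves
components packing at most `k / 2` each, and `exists_hitting_of_split` recurses into them; halving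
makes the total cost only twice that of the first split.

For edges, the vertices of `Y` cannot be deleted. If at some vertex `v` every component of the rest,
taken with its edges to `v`, packs at most `k / 2`, then splitting at `v` is free. Otherwise each
`v` has a component `D v` packing more than `k / 2`. Only `O(r * k)` edges join `v` to `D v`, by a
claw-free argument (`packs_of_starEdges`), and these are cut for all `v ∈ Y`. A remaining part
packing more than `k / 2` would contain some `v ∈ Y`, hence be edge-disjoint from the models at `D
v`, and the two would pack `k + 1`. -/

namespace ErdosPosa

/-! ### Connected sets and Menger's theorem. -/

section Connectivity

variable {α : Type*}

/-- `b` can be reached from `a` by steps of the relation `R` that stay inside `U`. -/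
def Joined (R : α → α → Prop) (U : Set α) : α → α → Prop :=
  Relation.ReflTransGen (fun x y => R x y ∧ x ∈ U ∧ y ∈ U)

/-- The set `U` is nonempty and connected with respect to the relation `R`. -/
def Conn (R : α → α → Prop) (U : Set α) : Prop :=
  U.Nonempty ∧ ∀ a ∈ U, ∀ b ∈ U, Joined R U a b

variable {R R' : α → α → Prop} {U W : Set α} {a b c : α}

theorem Joined.refl (a : α) : Joined R U a a := Relation.ReflTransGen.refl

theorem Joined.trans (h : Joined R U a b) (h' : Joined R U b c) : Joined R U a c :=
  Relation.ReflTransGen.trans h h'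

theorem Joined.single (h : R a b) (ha : a ∈ U) (hb : b ∈ U) : Joined R U a b :=
  Relation.ReflTransGen.single ⟨h, ha, hb⟩

theorem Joined.symm (hR : ∀ x y, R x y → R y x) (h : Joined R U a b) : Joined R U b a := by
  induction h with
  | refl => exact .refl _
  | tail _ hs ih => exact (Joined.single (hR _ _ hs.1) hs.2.2 hs.2.1).trans ih

theorem Joined.mono (h : Joined R U a b) (hR : ∀ x ∈ U, ∀ y ∈ U, R x y → R' x y) (hU : U ⊆ W) :
    Joined R' W a b := by
  induction h with
  | refl => exact .refl _
  | tail _ hs ih =>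
    exact ih.trans (.single (hR _ hs.2.1 _ hs.2.2 hs.1) (hU hs.2.1) (hU hs.2.2))

theorem Joined.mono_set (h : Joined R U a b) (hU : U ⊆ W) : Joined R W a b :=
  h.mono (fun _ _ _ _ h => h) hU

theorem Joined.eq_or_left_mem (h : Joined R U a b) : a = b ∨ a ∈ U := by
  rcases Relation.ReflTransGen.cases_head h with h | ⟨c, hc, -⟩
  · exact .inl h
  · exact .inr hc.2.1

theorem Joined.eq_or_right_mem (h : Joined R U a b) : a = b ∨ b ∈ U := by
  rcases Relation.ReflTransGen.cases_tail h with h | ⟨c, -, hc⟩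
  · exact .inl h.symm
  · exact .inr hc.2.2

theorem Joined.right_mem (h : Joined R U a b) (ha : a ∈ U) : b ∈ U := by
  rcases h.eq_or_right_mem with rfl | h
  exacts [ha, h]

theorem Joined.left_mem (h : Joined R U a b) (hb : b ∈ U) : a ∈ U := by
  rcases h.eq_or_left_mem with rfl | h
  exacts [hb, h]

/-- A walk from inside `W` to outside must cross the boundary. Usually `W` is a set of reachable
points, so the crossing step is either impossible or the edge being sought. -/
theorem Joined.exists_exit (h : Joined R U a b) (ha : a ∈ W) (hb : b ∉ W) :
    ∃ u ∈ W, ∃ v, v ∉ W ∧ R u v ∧ u ∈ U ∧ v ∈ U := by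
  induction h with
  | refl => exact absurd ha hb
  | @tail x y _ hs ih =>
    by_cases hx : x ∈ W
    · exact ⟨x, hx, y, hb, hs⟩
    · exact ih hx

theorem Joined.within (h : Joined R U a b) : Joined R {z | Joined R U a z} a b := by
  induction h with
  | refl => exact .refl _
  | @tail x y h hs ih => exact ih.trans (.single hs.1 h (h.tail hs))

/-- A path from `a` to a different `b` may be assumed not to return to `a`. -/
theorem Joined.exists_step (h : Joined R U a b) (hab : a ≠ b) :
    ∃ c, R a c ∧ c ∈ U ∧ c ≠ a ∧ Joined R (U \ {a}) c b := by
  induction h with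
  | refl => exact absurd rfl hab
  | @tail x y h hs ih =>
    by_cases hx : a = x
    · subst hx
      exact ⟨y, hs.1, hs.2.2, hab.symm, .refl _⟩
    · obtain ⟨c, h1, h2, h3, h4⟩ := ih hx
      exact ⟨c, h1, h2, h3, h4.trans (.single hs.1 ⟨hs.2.1, fun h => hx h.symm⟩
        ⟨hs.2.2, fun h => hab h.symm⟩)⟩

theorem Conn.singleton (a : α) : Conn R {a} :=
  ⟨Set.singleton_nonempty a, by rintro _ rfl _ rfl; exact .refl _⟩

theorem Conn.mono (h : Conn R U) (hR : ∀ x ∈ U, ∀ y ∈ U, R x y → R' x y) : Conn R' U :=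
  ⟨h.1, fun a ha b hb => (h.2 a ha b hb).mono hR subset_rfl⟩

theorem conn_of_center (hR : ∀ x y, R x y → R y x) (ha : a ∈ U) (h : ∀ b ∈ U, Joined R U a b) :
    Conn R U :=
  ⟨⟨a, ha⟩, fun b hb c hc => ((h b hb).symm hR).trans (h c hc)⟩

theorem conn_joined (hR : ∀ x y, R x y → R y x) (a : α) : Conn R {z | Joined R U a z} :=
  conn_of_center hR (Joined.refl a) fun _ hb => Joined.within hb

theorem Conn.union (hR : ∀ x y, R x y → R y x) (hU : Conn R U) (hW : Conn R W)
    (h : ∃ u ∈ U, ∃ w ∈ W, u = w ∨ R u w) : Conn R (U ∪ W) := by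
  obtain ⟨u, hu, w, hw, huw⟩ := h
  refine conn_of_center hR (a := u) (.inl hu) ?_
  have h1 : Joined R (U ∪ W) u w := by
    rcases huw with rfl | huw
    · exact .refl _
    · exact .single huw (.inl hu) (.inr hw)
  rintro b (hb | hb)
  · exact (hU.2 u hu b hb).mono_set Set.subset_union_left
  · exact h1.trans ((hW.2 w hw b hb).mono_set Set.subset_union_right)

/-- A connected set meeting `A` and `X` contains a connected subset that meets `A`, has exactly
one element in `X`, and whose elements are all reachable from `A` outside `X`. -/
theorem Conn.exists_thin (hR : ∀ x y, R x y → R y x) {P A X : Set α} (hP : Conn R P)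
    (hA : (P ∩ A).Nonempty) (hX : (P ∩ X).Nonempty) :
    ∃ s ∈ X, ∃ a ∈ A, ∃ P' ⊆ P, s ∈ P' ∧ a ∈ P' ∧ Conn R P' ∧ (∀ z ∈ P', z ∈ X → z = s) ∧
      ∀ z ∈ P', Joined R (insert z (P' \ X)) a z := by
  obtain ⟨a, haP, haA⟩ := hA
  obtain ⟨x, hxP, hxX⟩ := hX
  by_cases haX : a ∈ X
  · refine ⟨a, haX, a, haA, {a}, by simpa using haP, rfl, rfl, .singleton a,
      fun z hz _ => hz, ?_⟩
    rintro z rfl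
    exact .refl _
  · set W : Set α := {z | Joined R (P \ X) a z} with hW
    have hWX : W ⊆ P \ X := fun z hz => Joined.right_mem hz ⟨haP, haX⟩
    obtain ⟨w, hw, s, hs, hws, hwP, hsP⟩ := (hP.2 a haP x hxP).exists_exit (W := W) (.refl a)
      (fun h => (hWX h).2 hxX)
    have hsX : s ∈ X := by
      by_contra hsX
      exact hs (Joined.trans hw (.single hws (hWX hw) ⟨hsP, hsX⟩))
    have hsub : W ⊆ (insert s W) \ X := fun z hz => ⟨.inr hz, (hWX hz).2⟩
    refine ⟨s, hsX, a, haA, insert s W, ?_, .inl rfl, .inr (.refl a), ?_, ?_, ?_⟩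
    · rintro z (rfl | hz)
      exacts [hsP, (hWX hz).1]
    · rw [← Set.union_singleton]
      exact (conn_joined hR a).union hR (.singleton s) ⟨w, hw, s, rfl, .inr hws⟩
    · rintro z (rfl | hz) hzX
      exacts [rfl, absurd hzX (hWX hz).2]
    · rintro z (rfl | hz)
      · exact (Joined.within hw |>.mono_set (hsub.trans (Set.subset_insert _ _))).trans
          (.single hws (.inr (hsub hw)) (.inl rfl))
      · exact Joined.within hz |>.mono_set (hsub.trans (Set.subset_insert _ _))

/-- A connected set meeting the disjoint sets `A` and `B` contains a connected subset outside
`A` with exactly one element in `B` and with a neighbour in `A`. -/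
theorem Conn.exists_link (hR : ∀ x y, R x y → R y x) {P A B : Set α} (hP : Conn R P)
    (hA : (P ∩ A).Nonempty) (hB : (P ∩ B).Nonempty) (hAB : Disjoint A B) :
    ∃ a ∈ P ∩ A, ∃ W ⊆ P \ A, Conn R W ∧ (∃ w ∈ W, R a w) ∧
      ∃ s ∈ W ∩ B, ∀ z ∈ W ∩ B, z = s := by
  obtain ⟨s, hsB, a', ha', P', hP'P, hsP', ha'P', hP', hs, -⟩ := hP.exists_thin hR hA hB
  have hsA : s ∉ A := fun h => Set.disjoint_left.1 hAB h hsB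
  set W : Set α := {z | Joined R (P' \ A) s z} with hW
  have hWA : W ⊆ P' \ A := fun z hz => Joined.right_mem hz ⟨hsP', hsA⟩
  obtain ⟨w, hw, a, ha, hwa, hwP, haP⟩ := (hP'.2 s hsP' a' ha'P').exists_exit (W := W) (.refl s)
    (fun h => (hWA h).2 ha')
  have haA : a ∈ A := by
    by_contra haA
    exact ha (Joined.trans hw (.single hwa (hWA hw) ⟨haP, haA⟩))
  exact ⟨a, ⟨hP'P haP, haA⟩, W, fun z hz => ⟨hP'P (hWA hz).1, (hWA hz).2⟩, conn_joined hR s,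
    ⟨w, hw, hR _ _ hwa⟩, s, ⟨.refl s, hsB⟩, fun z hz => hs z (hWA hz.1).1 hz.2⟩

/-- Used in Menger's theorem: `S` separates `A` from `B` once the edge `xy` is deleted. If `T` cut
`A` off from `S ∪ {x}`, the part reachable from `a` could be left only by the step from `y` to `x`;
then `y` would be reachable off `S`, and through it `B`. -/
theorem exists_joined_insert_of_separates {A B : Set α} {S : Finset α} {x y : α} {k : ℕ}
    (hRR' : ∀ u v, R u v → R' u v ∨ (u = x ∧ v = y) ∨ (u = y ∧ v = x))
    (hsep : ∀ a ∈ A, ∀ b ∈ B, a ∉ S → b ∉ S → ¬ Joined R' (↑S)ᶜ a b)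
    (hy : ∃ b ∈ B, b ∉ S ∧ Joined R' (↑S)ᶜ y b)
    (hk : ∀ T : Finset α, T.card < k → ∃ a ∈ A, ∃ b ∈ B, a ∉ T ∧ b ∉ T ∧ Joined R (↑T)ᶜ a b)
    (T : Finset α) (hT : T.card < k) :
    ∃ a ∈ A, ∃ s ∈ insert x (S : Set α), a ∉ T ∧ s ∉ T ∧ Joined R' (↑T)ᶜ a s := by
  by_contra! hcon
  obtain ⟨a, ha, b, hb, haT, hbT, hab⟩ := hk T hT
  set W : Set α := {z | Joined R' (↑T)ᶜ a z} with hW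
  have hWT : ∀ z ∈ W, z ∉ T := fun z hz => by
    simpa using Joined.right_mem hz (by simpa using haT)
  have hWS : ∀ z ∈ W, z ∉ insert x (S : Set α) := fun z hz hzS =>
    hcon a ha z hzS haT (hWT z hz) hz
  have hWS' : W ⊆ (↑S)ᶜ := fun z hz h => hWS z hz (.inr h)
  have haW : a ∈ W := .refl a
  by_cases hbW : b ∈ W
  · exact hsep a ha b hb (hWS' haW) (hWS' hbW) ((Joined.within hbW).mono_set hWS')
  · obtain ⟨u, hu, v, hv, huv, huT, hvT⟩ := hab.exists_exit haW hbW
    rcases hRR' u v huv with h | ⟨rfl, rfl⟩ | ⟨rfl, rfl⟩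
    · exact hv (Joined.trans hu (.single h huT hvT))
    · exact hWS u hu (.inl rfl)
    · obtain ⟨b', hb', hb'S, hub'⟩ := hy
      exact hsep a ha b' hb' (hWS' haW) hb'S
        (((Joined.within hu).mono_set hWS').trans hub')

theorem Finset.exists_eq_of_injective_of_card {k : ℕ} {s : Fin k → α} (hs : Function.Injective s)
    {X : Finset α} (hX : ∀ i, s i ∈ X) (hk : X.card ≤ k) {x : α} (hx : x ∈ X) : ∃ i, s i = x := by
  classical
  have h : Finset.univ.image s = X := by
    refine Finset.eq_of_subset_of_card_le (fun z hz => ?_) ?_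
    · obtain ⟨i, -, rfl⟩ := Finset.mem_image.1 hz
      exact hX i
    · rw [Finset.card_image_of_injective _ hs]
      simpa using hk
  rw [← h] at hx
  obtain ⟨i, -, hi⟩ := Finset.mem_image.1 hx
  exact ⟨i, hi⟩

/-- There are `k` pairwise disjoint connected sets that all meet both `A` and `B`. -/
def Linked (R : α → α → Prop) (A B : Set α) (k : ℕ) : Prop :=
  ∃ Q : Fin k → Set α, (∀ i, Conn R (Q i) ∧ (Q i ∩ A).Nonempty ∧ (Q i ∩ B).Nonempty) ∧
    ∀ i j, i ≠ j → Disjoint (Q i) (Q j)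

theorem Linked.symm {A B : Set α} {k : ℕ} (h : Linked R A B k) : Linked R B A k := by
  obtain ⟨Q, hQ, hd⟩ := h
  exact ⟨Q, fun i => ⟨(hQ i).1, (hQ i).2.2, (hQ i).2.1⟩, hd⟩

/-- Disjoint sets have distinct representatives in `X`, and `X` has at most `k` elements, so the
representatives exhaust `X`. Each set may be shrunk to meet `X` only once. -/
theorem Linked.exists_thin (hR : ∀ x y, R x y → R y x) {A : Set α} {X : Finset α} {k : ℕ}
    (h : Linked R A X k) (hX : X.card ≤ k) :
    ∃ (P : Fin k → Set α) (s : Fin k → α), (∀ i, Conn R (P i) ∧ s i ∈ P i ∧ s i ∈ X ∧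
      (∀ z ∈ P i, z ∈ X → z = s i) ∧
      ∃ a ∈ A, a ∈ P i ∧ ∀ z ∈ P i, Joined R (insert z (P i \ X)) a z) ∧
      Function.Injective s ∧ (∀ x ∈ X, ∃ i, s i = x) ∧
      ∀ i j, i ≠ j → Disjoint (P i) (P j) := by
  obtain ⟨P, hP, hPd⟩ := h
  choose s hsX a haA P' hP'P hsP' haP' hP'c hs hz using
    fun i => (hP i).1.exists_thin hR (hP i).2.1 (hP i).2.2
  have hsinj : Function.Injective s := by
    intro i j hij
    by_contra hne
    exact Set.disjoint_left.1 (hPd i j hne) (hP'P i (hsP' i)) (hij ▸ hP'P j (hsP' j))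
  exact ⟨P', s, fun i => ⟨hP'c i, hsP' i, hsX i, hs i, a i, haA i, haP' i, hz i⟩, hsinj,
    fun x hx => Finset.exists_eq_of_injective_of_card hsinj hsX hX hx,
    fun i j hij => (hPd i j hij).mono (hP'P i) (hP'P j)⟩

/-- The sets `P i` and `Q j` can meet only in `S`: a common point elsewhere would be reachable from
both `A` and `B` off `S`. So each `P i` is glued to the `Q j` sharing its point of `S`, and the one
ending in `x` to the one ending in `y`, across the edge `xy`. -/
theorem Linked.combine [DecidableEq α] (hR : ∀ x y, R x y → R y x) (hR' : ∀ x y, R' x y → R' y x)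
    (hR'R : ∀ x y, R' x y → R x y) {A B : Set α} {S : Finset α} {x y : α} (hxy : R x y)
    (hx : x ∉ S) (hy : y ∉ S)
    (hsep : ∀ a ∈ A, ∀ b ∈ B, a ∉ S → b ∉ S → ¬ Joined R' (↑S)ᶜ a b) {k : ℕ}
    (hk : S.card + 1 = k) (hP : Linked R' A ↑(insert x S) k) (hQ : Linked R' B ↑(insert y S) k) :
    Linked R A B k := by
  obtain ⟨P, s, hP, hs, -, hPd⟩ := hP.exists_thin hR' (by rw [Finset.card_insert_of_notMem hx, hk])
  obtain ⟨Q, t, hQ, -, hty, hQd⟩ := hQ.exists_thin hR' (by rw [Finset.card_insert_of_notMem hy, hk])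
  have hPQ : ∀ i j z, z ∈ P i → z ∈ Q j → z ∈ S := by
    intro i j z hzP hzQ
    by_contra hzS
    obtain ⟨-, -, -, -, a, ha, haP, hPz⟩ := hP i
    obtain ⟨-, -, -, -, b, hb, hbQ, hQz⟩ := hQ j
    have h1 : insert z (P i \ ↑(insert x S)) ⊆ (↑S : Set α)ᶜ := by
      rintro w (rfl | hw) hwS
      exacts [hzS hwS, hw.2 (Finset.mem_coe.2 (Finset.mem_insert_of_mem hwS))]
    have h2 : insert z (Q j \ ↑(insert y S)) ⊆ (↑S : Set α)ᶜ := by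
      rintro w (rfl | hw) hwS
      exacts [hzS hwS, hw.2 (Finset.mem_coe.2 (Finset.mem_insert_of_mem hwS))]
    have h3 := (hPz z hzP).mono_set h1
    have h4 := (hQz z hzQ).mono_set h2
    have h5 : z ∈ (↑S : Set α)ᶜ := hzS
    exact hsep a ha b hb (h3.left_mem h5) (h4.left_mem h5) (h3.trans (h4.symm hR'))
  have hex : ∀ i, ∃ j, (s i = x ∧ t j = y) ∨ (s i ∈ S ∧ t j = s i) := by
    intro i
    rcases Finset.mem_insert.1 (hP i).2.2.1 with h | h
    · obtain ⟨j, hj⟩ := hty y (Finset.mem_insert_self y S)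
      exact ⟨j, .inl ⟨h, hj⟩⟩
    · obtain ⟨j, hj⟩ := hty (s i) (Finset.mem_insert_of_mem h)
      exact ⟨j, .inr ⟨h, hj⟩⟩
  choose σ hσ using hex
  have hσinj : ∀ i j, σ i = σ j → i = j := by
    intro i j hij
    apply hs
    have h1 := hσ i
    have h2 := hσ j
    rw [hij] at h1
    rcases h1 with ⟨h1, h1'⟩ | ⟨h1, h1'⟩ <;> rcases h2 with ⟨h2, h2'⟩ | ⟨h2, h2'⟩
    · rw [h1, h2]
    · exact absurd (h1' ▸ h2' ▸ h2) hy
    · exact absurd (h2' ▸ h1' ▸ h1) hy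
    · rw [← h1', ← h2']
  refine ⟨fun i => P i ∪ Q (σ i), fun i => ⟨?_, ?_, ?_⟩, ?_⟩
  · refine Conn.union hR ((hP i).1.mono fun _ _ _ _ => hR'R _ _)
      ((hQ (σ i)).1.mono fun _ _ _ _ => hR'R _ _) ⟨s i, (hP i).2.1, t (σ i), (hQ _).2.1, ?_⟩
    rcases hσ i with ⟨h, h'⟩ | ⟨h, h'⟩
    · rw [h, h']; exact .inr hxy
    · exact .inl h'.symm
  · obtain ⟨-, -, -, -, a, ha, haP, -⟩ := hP i
    exact ⟨a, .inl haP, ha⟩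
  · obtain ⟨-, -, -, -, b, hb, hbQ, -⟩ := hQ (σ i)
    exact ⟨b, .inr hbQ, hb⟩
  · have key : ∀ i j z, z ∈ P i → z ∈ Q (σ j) → i = j := by
      intro i j z hzP hzQ
      have hzS := hPQ _ _ _ hzP hzQ
      have h1 := (hP i).2.2.2.1 z hzP (Finset.mem_coe.2 (Finset.mem_insert_of_mem hzS))
      have h2 := (hQ (σ j)).2.2.2.1 z hzQ (Finset.mem_coe.2 (Finset.mem_insert_of_mem hzS))
      apply hs
      rcases hσ j with ⟨h, h'⟩ | ⟨h, h'⟩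
      · exact absurd (h' ▸ h2 ▸ hzS) hy
      · rw [← h1, ← h', ← h2]
    intro i j hij
    rw [Set.disjoint_left]
    rintro z (hz | hz) (hz' | hz')
    · exact Set.disjoint_left.1 (hPd i j hij) hz hz'
    · exact hij (key _ _ _ hz hz')
    · exact hij (key _ _ _ hz' hz).symm
    · exact Set.disjoint_left.1 (hQd _ _ fun h => hij (hσinj _ _ h)) hz hz'

/-- Menger's theorem: if no set of fewer than `k` vertices separates `A` from `B`, then `k`
pairwise disjoint connected sets meet both `A` and `B`. -/
theorem menger (hR : ∀ x y, R x y → R y x) (hfin : {p : α × α | R p.1 p.2}.Finite) {A B : Set α}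
    {k : ℕ} (hk : ∀ T : Finset α, T.card < k →
      ∃ a ∈ A, ∃ b ∈ B, a ∉ T ∧ b ∉ T ∧ Joined R (↑T)ᶜ a b) : Linked R A B k := by
  classical
  -- Induction by deleting an edge `xy`. If a set `S` of fewer than `k` vertices now separates, then
  -- `S ∪ {x}` and `S ∪ {y}` have exactly `k` elements, and the linkages given by induction from `A`
  -- and `B` to them are combined.
  induction hn : {p : α × α | R p.1 p.2}.ncard using Nat.strong_induction_on
    generalizing R A B with
  | _ n ih =>
  by_cases hE : ∃ x y, R x y
  · obtain ⟨x, y, hxy⟩ := hE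
    set R' : α → α → Prop := fun u v => R u v ∧ ¬ (u = x ∧ v = y) ∧ ¬ (u = y ∧ v = x) with hR'def
    have hR' : ∀ u v, R' u v → R' v u := fun u v h =>
      ⟨hR _ _ h.1, fun h' => h.2.2 ⟨h'.2, h'.1⟩, fun h' => h.2.1 ⟨h'.2, h'.1⟩⟩
    have hR'R : ∀ u v, R' u v → R u v := fun u v h => h.1
    have hRR' : ∀ u v, R u v → R' u v ∨ (u = x ∧ v = y) ∨ (u = y ∧ v = x) := by
      intro u v h
      by_contra! hcon
      exact hcon.1 ⟨h, fun h' => hcon.2.1 h'.1 h'.2, fun h' => hcon.2.2 h'.1 h'.2⟩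
    have hfin' : {p : α × α | R' p.1 p.2}.Finite := hfin.subset fun p hp => hp.1
    have hlt : {p : α × α | R' p.1 p.2}.ncard < n := by
      rw [← hn]
      exact Set.ncard_lt_ncard ⟨fun p hp => hp.1,
        fun h => (h (show R (x, y).1 (x, y).2 from hxy)).2.1 ⟨rfl, rfl⟩⟩ hfin
    by_cases hsep : ∀ T : Finset α, T.card < k →
        ∃ a ∈ A, ∃ b ∈ B, a ∉ T ∧ b ∉ T ∧ Joined R' (↑T)ᶜ a b
    · obtain ⟨Q, hQ, hd⟩ := ih _ hlt hR' hfin' hsep rfl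
      exact ⟨Q, fun i => ⟨(hQ i).1.mono fun _ _ _ _ => hR'R _ _, (hQ i).2⟩, hd⟩
    · push Not at hsep
      obtain ⟨S, hSk, hsep⟩ := hsep
      obtain ⟨a, ha, b, hb, haS, hbS, hab⟩ := hk S hSk
      have main : ∀ x y, R x y → (∀ u v, R u v → R' u v ∨ (u = x ∧ v = y) ∨ (u = y ∧ v = x)) →
          x ∉ S → y ∉ S → Joined R' (↑S)ᶜ a x → Joined R' (↑S)ᶜ y b → Linked R A B k := by
        intro x y hxy hRR' hxS hyS hax hyb
        have h1 := exists_joined_insert_of_separates hRR' hsep ⟨b, hb, hbS, hyb⟩ hk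
        have h2 := exists_joined_insert_of_separates (A := B) (B := A) (S := S) (x := y) (y := x)
          (k := k) (fun u v h => (hRR' u v h).imp_right Or.symm)
          (fun b hb a ha hbS haS h => hsep a ha b hb haS hbS (h.symm hR'))
          ⟨a, ha, haS, hax.symm hR'⟩ (fun T hT => by
            obtain ⟨a, ha, b, hb, haT, hbT, h⟩ := hk T hT
            exact ⟨b, hb, a, ha, hbT, haT, h.symm hR⟩)
        have hcard : S.card + 1 = k := by
          by_contra hne
          obtain ⟨a', -, s, hs, -, hsT, -⟩ := h1 (insert x S)
            (by rw [Finset.card_insert_of_notMem hxS]; omega)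
          exact hsT (by simpa using hs)
        exact Linked.combine hR hR' hR'R hxy hxS hyS hsep hcard
          (ih _ hlt hR' hfin' (by simpa using h1) rfl) (ih _ hlt hR' hfin' (by simpa using h2) rfl)
      set W : Set α := {z | Joined R' (↑S)ᶜ a z} with hW
      set W' : Set α := {z | Joined R' (↑S)ᶜ b z} with hW'
      obtain ⟨u, hu, v, hv, huv, huS, hvS⟩ := hab.exists_exit (W := W) (.refl a)
        (hsep a ha b hb haS hbS)
      obtain ⟨u', hu', v', hv', huv', huS', hvS'⟩ := (hab.symm hR).exists_exit (W := W') (.refl b)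
        (fun h => hsep a ha b hb haS hbS (Joined.symm hR' h))
      have hbad : ¬ R' u v := fun h => hv (Joined.trans hu (.single h huS hvS))
      have hbad' : ¬ R' u' v' := fun h => hv' (Joined.trans hu' (.single h huS' hvS'))
      have hcon : ∀ z, z ∈ W → z ∈ W' → False := fun z hz hz' =>
        hsep a ha b hb haS hbS (Joined.trans hz (Joined.symm hR' hz'))
      -- Leaving either side off `S` requires the deleted edge. The two exits cannot start at the
      -- same end, so one end is reached from `a` and the other from `b`.
      rcases hRR' u v huv with h | ⟨rfl, rfl⟩ | ⟨rfl, rfl⟩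
      · exact absurd h hbad
      · rcases hRR' u' v' huv' with h | ⟨rfl, rfl⟩ | ⟨rfl, rfl⟩
        · exact absurd h hbad'
        · exact (hcon _ hu hu').elim
        · exact main _ _ huv hRR' huS hvS hu (Joined.symm hR' hu')
      · rcases hRR' u' v' huv' with h | ⟨rfl, rfl⟩ | ⟨rfl, rfl⟩
        · exact absurd h hbad'
        · exact main _ _ huv (fun u v h => (hRR' u v h).imp_right Or.symm) huS hvS hu
            (Joined.symm hR' hu')
        · exact (hcon _ hu hu').elim
  · push Not at hE
    have hJ : ∀ (U : Set α) (a b), Joined R U a b → a = b := by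
      intro U a b h
      rcases Relation.ReflTransGen.cases_head h with h | ⟨c, hc, -⟩
      exacts [h, absurd hc.1 (hE _ _)]
    have hex : ∃ T : Finset α, ↑T ⊆ A ∩ B ∧ T.card = k := by
      by_cases hf : (A ∩ B).Finite
      · by_contra hcon
        have hlt : hf.toFinset.card < k := by
          by_contra hge
          obtain ⟨T, hT, hTk⟩ := Finset.exists_subset_card_eq (not_lt.1 hge)
          exact hcon ⟨T, fun z hz => hf.mem_toFinset.1 (hT hz), hTk⟩
        obtain ⟨a, ha, b, hb, haT, -, hab⟩ := hk _ hlt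
        exact haT (hf.mem_toFinset.2 ⟨ha, hJ _ _ _ hab ▸ hb⟩)
      · exact Set.Infinite.exists_subset_card_eq hf k
    obtain ⟨T, hT, rfl⟩ := hex
    refine ⟨fun i => {(T.equivFin.symm i : α)}, fun i => ⟨.singleton _, ?_, ?_⟩, ?_⟩
    · exact ⟨_, rfl, (hT (T.equivFin.symm i).2).1⟩
    · exact ⟨_, rfl, (hT (T.equivFin.symm i).2).2⟩
    · intro i j hij
      simpa [Subtype.val_inj] using hij

end Connectivity
-- Brambles, a path through all members, and a linkage between two subpaths.
section Brambles

variable {α : Type*} {R : α → α → Prop}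

/-- A family of pairwise intersecting connected sets is hit by a single path. -/
theorem exists_path_meeting_all (hR : ∀ x y, R x y → R y x) {V : Set α} (hV : V.Finite)
    {BB : Set (Set α)} (hBV : ∀ b ∈ BB, b ⊆ V) (hconn : ∀ b ∈ BB, Conn R b)
    (hint : ∀ b ∈ BB, ∀ b' ∈ BB, (b ∩ b').Nonempty) :
    ∃ l : List α, l.Nodup ∧ l.IsChain R ∧ ∀ b ∈ BB, ∃ x ∈ l, x ∈ b := by
  classical
  by_contra! hcon
  -- Invariant: the path grows at its head `v`; it misses the member `b`, and `v` can still reach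
  -- `b` inside `U`, which avoids the earlier vertices. Paths of every length would result, against
  -- finiteness of `V`.
  have key : ∀ n : ℕ, ∃ (v : α) (l : List α) (U b : Set α) (w : α), l.length = n ∧
      (v :: l).Nodup ∧ (v :: l).IsChain R ∧ (∀ x ∈ v :: l, x ∈ V) ∧ b ∈ BB ∧
      (∀ x ∈ v :: l, x ∉ b) ∧ U ⊆ V ∧ (∀ x ∈ l, x ∉ U) ∧ w ∈ b ∧ Joined R U v w := by
    intro n
    induction n with
    | zero =>
      obtain ⟨b₀, hb₀, -⟩ := hcon [] List.nodup_nil .nil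
      obtain ⟨v, hv⟩ := (hconn b₀ hb₀).1
      obtain ⟨b, hb, hvb⟩ := hcon [v] (List.nodup_singleton v) (.singleton v)
      obtain ⟨w, hw₀, hw⟩ := hint b₀ hb₀ b hb
      exact ⟨v, [], b₀, b, w, rfl, List.nodup_singleton v, .singleton v,
        by simpa using hBV b₀ hb₀ hv, hb, hvb, hBV b₀ hb₀, by simp, hw,
        (hconn b₀ hb₀).2 v hv w hw₀⟩
    | succ n ih =>
      obtain ⟨v, l, U, b, w, hlen, hnd, hch, hlV, hb, hlb, hUV, hlU, hw, hJ⟩ := ih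
      have hvw : v ≠ w := fun h => hlb v List.mem_cons_self (h ▸ hw)
      obtain ⟨c, hvc, hcU, hcv, hJc⟩ := hJ.exists_step hvw
      have hnd' : (c :: v :: l).Nodup := by
        refine List.nodup_cons.2 ⟨fun h => ?_, hnd⟩
        rcases List.mem_cons.1 h with h | h
        exacts [hcv h, hlU c h hcU]
      have hch' : (c :: v :: l).IsChain R := .cons_cons (hR _ _ hvc) hch
      have hV' : ∀ x ∈ c :: v :: l, x ∈ V := by
        intro x hx
        rcases List.mem_cons.1 hx with rfl | hx
        exacts [hUV hcU, hlV x hx]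
      by_cases hcb : c ∈ b
      -- The path has just entered `b`, so all of `b` except `c` is unused: `b` becomes the new `U`,
      -- and it meets the next missed member `b'`.
      · obtain ⟨b', hb', hlb'⟩ := hcon _ hnd' hch'
        obtain ⟨w', hw', hw''⟩ := hint b hb b' hb'
        exact ⟨c, v :: l, b, b', w', by simp [hlen], hnd', hch', hV', hb', hlb', hBV b hb, hlb,
          hw'', (hconn b hb).2 c hcb w' hw'⟩
      · refine ⟨c, v :: l, U \ {v}, b, w, by simp [hlen], hnd', hch', hV', hb, ?_,
          Set.sdiff_subset.trans hUV, ?_, hw, hJc⟩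
        · intro x hx
          rcases List.mem_cons.1 hx with rfl | hx
          exacts [hcb, hlb x hx]
        · intro x hx h
          rcases List.mem_cons.1 hx with rfl | hx
          exacts [h.2 rfl, hlU x hx h.1]
  obtain ⟨v, l, -, -, -, hlen, hnd, -, hlV, -⟩ := key V.ncard
  have h1 : (v :: l).toFinset.card ≤ V.ncard := by
    rw [← Set.ncard_coe_finset]
    exact Set.ncard_le_ncard (fun x hx => hlV x (by simpa using hx)) hV
  rw [List.toFinset_card_of_nodup hnd, List.length_cons] at h1
  omega

/-- From sufficiently large sets of labelled points one can select subsets of size `r` whose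
labels are separated from each other. -/
theorem exists_separated_subsets {ι κ : Type*} {b : κ → ℕ} (hb : Function.Injective b) {r : ℕ}
    (hr : 1 ≤ r) (s : Finset ι) (T : ι → Finset κ) (hT : ∀ i ∈ s, s.card * r ≤ (T i).card) :
    ∃ T' : ι → Finset κ, (∀ i ∈ s, T' i ⊆ T i ∧ (T' i).card = r) ∧
      ∀ i ∈ s, ∀ j ∈ s, i ≠ j →
        (∀ x ∈ T' i, ∀ y ∈ T' j, b x < b y) ∨ (∀ x ∈ T' i, ∀ y ∈ T' j, b y < b x) := by
  classical
  induction hn : s.card generalizing s T with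
  | zero =>
    obtain rfl := Finset.card_eq_zero.1 hn
    exact ⟨T, by simp, by simp⟩
  | succ n ih =>
    -- Cut at the least threshold `m` at which some set has `r` points. By minimality, and since
    -- labels are injective, no other set loses more than `r` points, exactly the loss that the size
    -- hypothesis allows per round.
    have hex : ∃ m, ∃ i ∈ s, r ≤ {x ∈ T i | b x ≤ m}.card := by
      obtain ⟨i, hi⟩ : s.Nonempty := Finset.card_pos.1 (by omega)
      refine ⟨(T i).sup b, i, hi, ?_⟩
      rw [Finset.filter_true_of_mem fun x hx => Finset.le_sup hx]
      exact le_trans (Nat.le_mul_of_pos_left r (by omega)) (hT i hi)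
    obtain ⟨i, hi, hri⟩ := Nat.find_spec hex
    set m := Nat.find hex with hm
    have hlow : ∀ j ∈ s, {x ∈ T j | b x ≤ m}.card ≤ r := by
      intro j hj
      have h1 : {x ∈ T j | b x < m}.card < r := by
        rcases Nat.eq_zero_or_pos m with h0 | hpos
        · simp [h0]; omega
        · have h2 := Nat.find_min hex (m := m - 1) (by omega)
          push Not at h2
          have h3 := h2 j hj
          have h4 : {x ∈ T j | b x < m} = {x ∈ T j | b x ≤ m - 1} :=
            Finset.filter_congr fun x _ => by omega
          rwa [h4]
      have h2 : {x ∈ T j | b x = m}.card ≤ 1 := by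
        refine Finset.card_le_one.2 fun x hx y hy => hb ?_
        rw [(Finset.mem_filter.1 hx).2, (Finset.mem_filter.1 hy).2]
      have h3 : {x ∈ T j | b x ≤ m} = {x ∈ T j | b x < m} ∪ {x ∈ T j | b x = m} := by
        rw [← Finset.filter_or]
        exact Finset.filter_congr fun x _ => le_iff_lt_or_eq
      have h4 := Finset.card_union_le {x ∈ T j | b x < m} {x ∈ T j | b x = m}
      rw [← h3] at h4
      omega
    obtain ⟨Ti, hTi, hTir⟩ := Finset.exists_subset_card_eq hri
    obtain ⟨T', hT', hsep⟩ := ih (s.erase i) (fun j => {x ∈ T j | m < b x}) (by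
      intro j hj
      have hj' := Finset.mem_of_mem_erase hj
      have h1 := hT j hj'
      have h2 := hlow j hj'
      have h3 := Finset.card_filter_add_card_filter_not (s := T j) (fun x => b x ≤ m)
      simp only [not_le] at h3
      rw [Finset.card_erase_of_mem hi, hn, Nat.add_sub_cancel]
      rw [hn, Nat.succ_mul] at h1
      omega) (by rw [Finset.card_erase_of_mem hi]; omega)
    have hbi : ∀ x ∈ Ti, b x ≤ m := fun x hx => (Finset.mem_filter.1 (hTi hx)).2
    have hbj : ∀ j ∈ s, j ≠ i → ∀ x ∈ T' j, m < b x := fun j hj hji x hx =>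
      (Finset.mem_filter.1 ((hT' j (Finset.mem_erase.2 ⟨hji, hj⟩)).1 hx)).2
    refine ⟨Function.update T' i Ti, fun j hj => ?_, fun j hj k hk hjk => ?_⟩
    · by_cases hji : j = i
      · subst hji
        simpa using ⟨hTi.trans (Finset.filter_subset _ _), hTir⟩
      · rw [Function.update_of_ne hji]
        have h := hT' j (Finset.mem_erase.2 ⟨hji, hj⟩)
        exact ⟨h.1.trans (Finset.filter_subset _ _), h.2⟩
    · by_cases hji : j = i
      · subst hji
        left
        rw [Function.update_self, Function.update_of_ne hjk.symm]
        exact fun x hx y hy => (hbi x hx).trans_lt (hbj k hk hjk.symm y hy)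
      · by_cases hki : k = i
        · subst hki
          right
          rw [Function.update_self, Function.update_of_ne hji]
          exact fun x hx y hy => (hbi y hy).trans_lt (hbj j hj hji x hx)
        · rw [Function.update_of_ne hji, Function.update_of_ne hki]
          exact hsep j (Finset.mem_erase.2 ⟨hji, hj⟩) k (Finset.mem_erase.2 ⟨hki, hk⟩) hjk

/-- A path meeting all members of a bramble of order at least `2 * t` splits into two subpaths
that are joined by `t` disjoint connections. -/
theorem exists_path_linked (hR : ∀ x y, R x y → R y x)
    (hfin : {p : α × α | R p.1 p.2}.Finite) {V : Set α} (hV : V.Finite)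
    {BB : Set (Set α)} (hBV : ∀ b ∈ BB, b ⊆ V) (hconn : ∀ b ∈ BB, Conn R b)
    (hint : ∀ b ∈ BB, ∀ b' ∈ BB, (b ∩ b').Nonempty) {t : ℕ} (ht : 1 ≤ t)
    (hhit : ∀ Y : Finset α, Y.card < 2 * t → ∃ b ∈ BB, ∀ x ∈ Y, x ∉ b) :
    ∃ (l : List α) (n : ℕ), l.Nodup ∧ l.IsChain R ∧
      Linked R {x | ∃ j < n, l[j]? = some x} {x | ∃ j, n ≤ j ∧ l[j]? = some x} t := by
  classical
  obtain ⟨l, hnd, hch, hl⟩ := exists_path_meeting_all hR hV hBV hconn hint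
  -- The cut position is the least `n` such that fewer than `t` vertices never hit all members
  -- meeting the first `n` positions.
  have hex : ∃ n : ℕ, ∀ Y : Finset α, Y.card < t →
      ∃ b ∈ BB, (∃ j : ℕ, j < n ∧ ∃ x : α, l[j]? = some x ∧ x ∈ b) ∧ ∀ x ∈ Y, x ∉ b := by
    refine ⟨l.length, fun Y hY => ?_⟩
    obtain ⟨b, hb, hbY⟩ := hhit Y (by omega)
    obtain ⟨x, hx, hxb⟩ := hl b hb
    obtain ⟨j, hj, rfl⟩ := List.mem_iff_getElem.1 hx
    exact ⟨b, hb, ⟨j, hj, _, List.getElem?_eq_getElem hj, hxb⟩, hbY⟩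
  have hn := Nat.find_spec hex
  set n := Nat.find hex with hndef
  have hpos : n ≠ 0 := by
    intro h0
    obtain ⟨b, -, ⟨j, hj, -⟩, -⟩ := hn ∅ (by rw [Finset.card_empty]; omega)
    omega
  have hmin := Nat.find_min hex (m := n - 1) (by omega)
  push Not at hmin
  obtain ⟨Y, hY, hYhit⟩ := hmin
  refine ⟨l, n, hnd, hch, menger hR hfin fun T hT => ?_⟩
  obtain ⟨b₁, hb₁, ⟨j₁, hj₁, a, haj, hab⟩, hT₁⟩ := hn T hT
  -- At most `(t - 1) + (t - 1) + 1 < 2 * t` vertices. Avoiding `Y` keeps `b₂` off the first `n - 1`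
  -- positions, and avoiding position `n - 1` forces it into the second subpath.
  obtain ⟨b₂, hb₂, hT₂⟩ := hhit (Y ∪ T ∪ (l[n - 1]?).toFinset) (by
    have h1 := Finset.card_union_le (Y ∪ T) (l[n - 1]?).toFinset
    have h2 := Finset.card_union_le Y T
    have h3 : (l[n - 1]?).toFinset.card ≤ 1 := by
      cases l[n - 1]? <;> simp
    omega)
  obtain ⟨y, hy, hyb⟩ := hl b₂ hb₂
  obtain ⟨j, hj, rfl⟩ := List.mem_iff_getElem.1 hy
  have hjn : n ≤ j := by
    by_contra hjn
    rcases Nat.lt_or_ge j (n - 1) with h | h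
    · obtain ⟨x, hxY, hxb⟩ := hYhit b₂ hb₂ ⟨j, h, _, List.getElem?_eq_getElem hj, hyb⟩
      exact hT₂ x (by simp [hxY]) hxb
    · obtain rfl : j = n - 1 := by omega
      exact hT₂ _ (by simp [List.getElem?_eq_getElem hj]) hyb
  have hT₂' : ∀ x ∈ T, x ∉ b₂ := fun x hx => hT₂ x (by simp [hx])
  obtain ⟨c, hc₁, hc₂⟩ := hint b₁ hb₁ b₂ hb₂
  refine ⟨a, ⟨j₁, hj₁, haj⟩, _, ⟨j, hjn, List.getElem?_eq_getElem hj⟩,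
    fun h => hT₁ _ h hab, fun h => hT₂' _ h hyb, ?_⟩
  exact (((hconn b₁ hb₁).2 a hab c hc₁).mono_set fun z hz h => hT₁ z h hz).trans
    (((hconn b₂ hb₂).2 c hc₂ _ hyb).mono_set fun z hz h => hT₂' z h hz)

end Brambles
-- Intervals of a path, and disjoint linked pairs from a bramble.
section Hulls

variable {α : Type*} {R : α → α → Prop} {κ : Type*}

/-- The elements of the list `l` in the interval spanned by the positions `p q`, `q ∈ T`. -/
def listHull (l : List α) (p : κ → ℕ) (T : Finset κ) : Set α :=
  {x | ∃ m, l[m]? = some x ∧ ∃ q ∈ T, ∃ q' ∈ T, p q ≤ m ∧ m ≤ p q'}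

variable {l : List α} {p : κ → ℕ} {T T' : Finset κ}

theorem mem_listHull {q : κ} (hq : q ∈ T) {x : α} (hx : l[p q]? = some x) :
    x ∈ listHull l p T :=
  ⟨p q, hx, q, hq, q, hq, le_rfl, le_rfl⟩

theorem joined_of_isChain (hl : l.IsChain R) {U : Set α} {m : ℕ} (d : ℕ)
    (hU : ∀ k, m ≤ k → k ≤ m + d → ∃ x ∈ U, l[k]? = some x) {x y : α}
    (hx : l[m]? = some x) (hy : l[m + d]? = some y) : Joined R U x y := by
  induction d generalizing y with
  | zero =>
    rw [Nat.add_zero, hx] at hy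
    cases hy
    exact .refl _
  | succ d ih =>
    obtain ⟨z, hzU, hz⟩ := hU (m + d) (by omega) (by omega)
    obtain ⟨y', hyU, hy'⟩ := hU (m + (d + 1)) (by omega) le_rfl
    rw [hy] at hy'
    cases hy'
    refine (ih (fun k h1 h2 => hU k h1 (by omega)) hz).trans (.single ?_ hzU hyU)
    obtain ⟨h1, rfl⟩ := List.getElem?_eq_some_iff.1 hz
    obtain ⟨h2, rfl⟩ := List.getElem?_eq_some_iff.1 hy
    exact List.isChain_iff_getElem.1 hl (m + d) h2

theorem conn_listHull (hR : ∀ x y, R x y → R y x) (hl : l.IsChain R) (hT : T.Nonempty)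
    (hp : ∀ q ∈ T, p q < l.length) : Conn R (listHull l p T) := by
  obtain ⟨q₀, hq₀⟩ := hT
  have hget : ∀ m < l.length, ∃ x, l[m]? = some x := fun m hm => ⟨_, List.getElem?_eq_getElem hm⟩
  obtain ⟨x₀, hx₀⟩ := hget _ (hp q₀ hq₀)
  refine conn_of_center hR (mem_listHull hq₀ hx₀) ?_
  rintro y ⟨m, hy, q, hq, q', hq', hqm, hmq'⟩
  rcases le_total (p q₀) m with h | h
  · refine joined_of_isChain hl (m - p q₀) (fun k h1 h2 => ?_) hx₀ (by rwa [Nat.add_sub_cancel' h])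
    have h3 := hp q' hq'
    obtain ⟨x, hx⟩ := hget k (by omega)
    exact ⟨x, ⟨k, hx, q₀, hq₀, q', hq', h1, by omega⟩, hx⟩
  · refine Joined.symm hR
      (joined_of_isChain hl (p q₀ - m) (fun k h1 h2 => ?_) hy (by rwa [Nat.add_sub_cancel' h]))
    have h3 := hp q₀ hq₀
    obtain ⟨x, hx⟩ := hget k (by omega)
    exact ⟨x, ⟨k, hx, q, hq, q₀, hq₀, by omega, by omega⟩, hx⟩

theorem List.Nodup.eq_of_getElem?_eq (hl : l.Nodup) {i j : ℕ} {x : α} (hi : l[i]? = some x)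
    (hj : l[j]? = some x) : i = j := by
  obtain ⟨h1, rfl⟩ := List.getElem?_eq_some_iff.1 hi
  obtain ⟨h2, h⟩ := List.getElem?_eq_some_iff.1 hj
  exact (hl.getElem_inj_iff.1 h).symm

theorem disjoint_listHull (hl : l.Nodup)
    (h : (∀ x ∈ T, ∀ y ∈ T', p x < p y) ∨ (∀ x ∈ T, ∀ y ∈ T', p y < p x)) :
    Disjoint (listHull l p T) (listHull l p T') := by
  rw [Set.disjoint_left]
  rintro x ⟨m, hx, q₁, h₁, q₂, h₂, h₃, h₄⟩ ⟨m', hx', q₁', h₁', q₂', h₂', h₃', h₄'⟩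
  obtain rfl := List.Nodup.eq_of_getElem?_eq hl hx hx'
  rcases h with h | h
  · have := h q₂ h₂ q₁' h₁'
    omega
  · have := h q₁ h₁ q₂' h₂'
    omega

/-- A bramble of large order yields many disjoint pairs of connected sets with many links. -/
theorem exists_disjoint_linked_pairs (hR : ∀ x y, R x y → R y x)
    (hfin : {p : α × α | R p.1 p.2}.Finite) {V : Set α} (hV : V.Finite)
    {BB : Set (Set α)} (hBV : ∀ b ∈ BB, b ⊆ V) (hconn : ∀ b ∈ BB, Conn R b)
    (hint : ∀ b ∈ BB, ∀ b' ∈ BB, (b ∩ b').Nonempty) {K r : ℕ} (hK : 1 ≤ K) (hr : 1 ≤ r)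
    (hhit : ∀ Y : Finset α, Y.card < 2 * (K * (K * r)) → ∃ b ∈ BB, ∀ x ∈ Y, x ∉ b) :
    ∃ A B : Fin K → Set α, (∀ i, Conn R (A i) ∧ Conn R (B i) ∧ ∃ f g : Fin r → α,
      Function.Injective f ∧ ∀ j, f j ∈ A i ∧ g j ∈ B i ∧ R (f j) (g j)) ∧
      (∀ i j, Disjoint (A i) (B j)) ∧
      ∀ i j, i ≠ j → Disjoint (A i) (A j) ∧ Disjoint (B i) (B j) := by
  classical
  obtain ⟨l, n, hnd, hch, Q, hQ, hQd⟩ :=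
    exists_path_linked hR hfin hV hBV hconn hint (Nat.mul_pos hK (Nat.mul_pos hK hr)) hhit
  set P₁ : Set α := {x | ∃ j < n, l[j]? = some x} with hP₁
  set P₂ : Set α := {x | ∃ j, n ≤ j ∧ l[j]? = some x} with hP₂
  have hP : Disjoint P₁ P₂ := by
    rw [Set.disjoint_left]
    rintro x ⟨j, hj, hx⟩ ⟨j', hj', hx'⟩
    have := List.Nodup.eq_of_getElem?_eq hnd hx hx'
    omega
  choose a ha W hW hWc hw s hsW hsu using
    fun q => (hQ q).1.exists_link hR (hQ q).2.1 (hQ q).2.2 hP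
  choose w hwW haw using hw
  have ha' : ∀ q, a q ∈ Q q ∧ ∃ j < n, l[j]? = some (a q) := ha
  have hs' : ∀ q, s q ∈ W q ∧ ∃ j, n ≤ j ∧ l[j]? = some (s q) := hsW
  choose haQ pa hpa hla using ha'
  choose hsWq pb hpb hlb using hs'
  have hpai : Function.Injective pa := by
    intro q q' h
    by_contra hne
    have h1 := hla q
    rw [h, hla q'] at h1
    have h2 : a q' = a q := by simpa using h1
    exact Set.disjoint_left.1 (hQd q q' hne) (haQ q) (h2 ▸ haQ q')
  have hpbi : Function.Injective pb := by
    intro q q' h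
    by_contra hne
    have h1 := hlb q
    rw [h, hlb q'] at h1
    have h2 : s q' = s q := by simpa using h1
    exact Set.disjoint_left.1 (hQd q q' hne) (hW q (hsWq q)).1 (h2 ▸ (hW q' (hsWq q')).1)
  -- Two rounds: `K` groups of `K * r` connections separated along the first subpath, then `r` from
  -- each group so that they are separated along the second subpath as well.
  obtain ⟨T₁, hT₁, hsep₁⟩ := exists_separated_subsets hpai (Nat.mul_pos hK hr)
    (Finset.univ : Finset (Fin K)) (fun _ => Finset.univ) (by simp)
  obtain ⟨T, hT, hsep⟩ := exists_separated_subsets hpbi hr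
    (Finset.univ : Finset (Fin K)) T₁ (fun i hi => by rw [(hT₁ i hi).2]; simp)
  have hsepa : ∀ i j, i ≠ j →
      (∀ x ∈ T i, ∀ y ∈ T j, pa x < pa y) ∨ (∀ x ∈ T i, ∀ y ∈ T j, pa y < pa x) := by
    intro i j hij
    have hi := (hT i (Finset.mem_univ i)).1
    have hj := (hT j (Finset.mem_univ j)).1
    exact (hsep₁ i (Finset.mem_univ i) j (Finset.mem_univ j) hij).imp
      (fun h x hx y hy => h x (hi hx) y (hj hy)) (fun h x hx y hy => h x (hi hx) y (hj hy))
  have hlen : ∀ {m : ℕ} {x : α}, l[m]? = some x → m < l.length := fun h =>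
    (List.getElem?_eq_some_iff.1 h).1
  have hTne : ∀ i, (T i).Nonempty := fun i =>
    Finset.card_pos.1 (by rw [(hT i (Finset.mem_univ i)).2]; exact hr)
  have hA : ∀ i, listHull l pa (T i) ⊆ P₁ := by
    rintro i x ⟨m, hx, -, -, q, -, -, h⟩
    exact ⟨m, h.trans_lt (hpa q), hx⟩
  have hB : ∀ i, listHull l pb (T i) ⊆ P₂ := by
    rintro i x ⟨m, hx, q, -, -, -, h, -⟩
    exact ⟨m, (hpb q).trans h, hx⟩
  have hBd : ∀ i j, i ≠ j → Disjoint (listHull l pb (T i)) (listHull l pb (T j)) := fun i j hij =>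
    disjoint_listHull hnd (hsep i (Finset.mem_univ i) j (Finset.mem_univ j) hij)
  -- A connection touches the second subpath only at its own endpoint, so it cannot run into the
  -- interval of another group.
  have hBW : ∀ i j, i ≠ j → ∀ z, ∀ q ∈ T j, z ∈ listHull l pb (T i) → z ∈ W q → False := by
    intro i j hij z q hq hz hzW
    obtain rfl := hsu q z ⟨hzW, hB i hz⟩
    exact Set.disjoint_left.1 (hBd i j hij) hz (mem_listHull hq (hlb q))
  refine ⟨fun i => listHull l pa (T i), fun i => listHull l pb (T i) ∪ ⋃ q ∈ T i, W q,
    fun i => ⟨?_, ?_, ?_⟩, fun i j => ?_, fun i j hij => ⟨?_, ?_⟩⟩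
  · exact conn_listHull hR hch (hTne i) fun q _ => hlen (hla q)
  · have hc := conn_listHull hR hch (hTne i) fun q _ => hlen (hlb q)
    obtain ⟨q₀, hq₀⟩ := hTne i
    have hq₀' := mem_listHull hq₀ (hlb q₀)
    refine conn_of_center hR (a := s q₀) (.inl hq₀') ?_
    rintro b (hb | hb)
    · exact (hc.2 _ hq₀' b hb).mono_set Set.subset_union_left
    · obtain ⟨q, hq, hbq⟩ := Set.mem_iUnion₂.1 hb
      refine ((hc.2 _ hq₀' _ (mem_listHull hq (hlb q))).mono_set Set.subset_union_left).trans
        (((hWc q).2 _ (hsWq q) b hbq).mono_set ?_)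
      exact fun z hz => .inr (Set.mem_iUnion₂.2 ⟨q, hq, hz⟩)
  · have e : Fin r ≃ T i := ((T i).equivFinOfCardEq (hT i (Finset.mem_univ i)).2).symm
    refine ⟨fun j => a (e j), fun j => w (e j), fun j j' h => ?_, fun j =>
      ⟨mem_listHull (e j).2 (hla _), .inr (Set.mem_iUnion₂.2 ⟨_, (e j).2, hwW _⟩), haw _⟩⟩
    have h1 := hla (e j)
    have h2 := hla (e j')
    rw [← show a (e j) = a (e j') from h] at h2
    exact e.injective (Subtype.ext (hpai (List.Nodup.eq_of_getElem?_eq hnd h1 h2)))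
  · rw [Set.disjoint_left]
    rintro z hz (hz' | hz')
    · exact Set.disjoint_left.1 hP (hA i hz) (hB j hz')
    · obtain ⟨q, -, hzq⟩ := Set.mem_iUnion₂.1 hz'
      exact (hW q hzq).2 (hA i hz)
  · exact disjoint_listHull hnd (hsepa i j hij)
  · rw [Set.disjoint_left]
    rintro z (hz | hz) (hz' | hz')
    · exact Set.disjoint_left.1 (hBd i j hij) hz hz'
    · obtain ⟨q, hq, hzq⟩ := Set.mem_iUnion₂.1 hz'
      exact hBW i j hij z q hq hz hzq
    · obtain ⟨q, hq, hzq⟩ := Set.mem_iUnion₂.1 hz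
      exact hBW j i hij.symm z q hq hz' hzq
    · obtain ⟨q, hq, hzq⟩ := Set.mem_iUnion₂.1 hz
      obtain ⟨q', hq', hzq'⟩ := Set.mem_iUnion₂.1 hz'
      refine Set.disjoint_left.1 (hQd q q' ?_) (hW q hzq).1 (hW q' hzq').1
      rintro rfl
      rcases hsepa i j hij with h | h
      exacts [lt_irrefl _ (h q hq q hq'), lt_irrefl _ (h q hq q hq')]

end Hulls
-- The divide-and-conquer bound for abstract set families.
section AbstractGap

variable {γ : Type*} {MM : Set (Set γ)} {U W : Set γ} {k m : ℕ}

/-- The set `U` contains `k` pairwise disjoint members of the family `MM`. -/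
def Packs (MM : Set (Set γ)) (U : Set γ) (k : ℕ) : Prop :=
  ∃ M : Fin k → Set γ, (∀ i, M i ∈ MM ∧ M i ⊆ U) ∧ ∀ i j, i ≠ j → Disjoint (M i) (M j)

theorem Packs.mono (h : Packs MM U k) (hU : U ⊆ W) (hm : m ≤ k) : Packs MM W m := by
  obtain ⟨M, hM, hd⟩ := h
  exact ⟨fun i => M (Fin.castLE hm i), fun i => ⟨(hM _).1, (hM _).2.trans hU⟩,
    fun i j hij => hd _ _ fun h => hij (Fin.castLE_injective hm h)⟩

theorem packs_zero (MM : Set (Set γ)) (U : Set γ) : Packs MM U 0 :=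
  ⟨fun i => i.elim0, fun i => i.elim0, fun i => i.elim0⟩

theorem packs_one {M : Set γ} (hM : M ∈ MM) (hU : M ⊆ U) : Packs MM U 1 :=
  ⟨fun _ => M, fun _ => ⟨hM, hU⟩, fun i j hij => absurd (Subsingleton.elim i j) hij⟩

theorem Packs.exists_mem (h : Packs MM U k) (hk : 1 ≤ k) : ∃ M ∈ MM, M ⊆ U := by
  obtain ⟨M, hM, -⟩ := h
  exact ⟨_, hM ⟨0, hk⟩⟩

theorem Packs.union (h : Packs MM U k) (h' : Packs MM W m) (hd : Disjoint U W) :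
    Packs MM (U ∪ W) (k + m) := by
  obtain ⟨M, hM, hMd⟩ := h
  obtain ⟨N, hN, hNd⟩ := h'
  refine ⟨Fin.append M N, fun i => ?_, fun i j => ?_⟩
  · refine Fin.addCases (fun i => ?_) (fun i => ?_) i
    · rw [Fin.append_left]
      exact ⟨(hM i).1, (hM i).2.trans Set.subset_union_left⟩
    · rw [Fin.append_right]
      exact ⟨(hN i).1, (hN i).2.trans Set.subset_union_right⟩
  · refine Fin.addCases (fun i => ?_) (fun i => ?_) i <;>
      refine Fin.addCases (fun j => ?_) (fun j => ?_) j <;>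
      simp only [Fin.append_left, Fin.append_right] <;> intro hij
    · exact hMd i j fun h => hij (by rw [h])
    · exact hd.mono (hM i).2 (hN j).2
    · exact hd.symm.mono (hN i).2 (hM j).2
    · exact hNd i j fun h => hij (by rw [h])

theorem exists_max_packs (h : ¬ Packs MM U (m + 1)) :
    ∃ j ≤ m, Packs MM U j ∧ ¬ Packs MM U (j + 1) := by
  induction m with
  | zero => exact ⟨0, le_rfl, packs_zero MM U, h⟩
  | succ m ih =>
    by_cases hm : Packs MM U (m + 1)
    · exact ⟨m + 1, le_rfl, hm, h⟩
    · obtain ⟨j, hj, h'⟩ := ih hm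
      exact ⟨j, hj.trans (Nat.le_succ m), h'⟩

/-- If the pieces of a partition can be hit cheaply, all members inside a piece can be hit. -/
theorem exists_hitting_of_fibres {ι : Type*} (P : γ → ι) {h q C : ℕ} {U : Set γ}
    (hcov : ∀ j ≤ h, ∀ W ⊆ U, ¬ Packs MM W (j + 1) →
      ∃ X : Finset γ, X.card ≤ C * j ^ (q + 1) ∧ ∀ M ∈ MM, M ⊆ W → ∃ x ∈ M, x ∈ X)
    (hfib : ∀ i, ¬ Packs MM (U ∩ P ⁻¹' {i}) (h + 1)) (hm : ¬ Packs MM U (m + 1)) :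
    ∃ X : Finset γ, X.card ≤ C * h ^ q * m ∧
      ∀ i, ∀ M ∈ MM, M ⊆ U ∩ P ⁻¹' {i} → ∃ x ∈ M, x ∈ X := by
  classical
  induction m using Nat.strong_induction_on generalizing U with
  | _ m ih =>
  by_cases hex : ∃ i, ∃ M ∈ MM, M ⊆ U ∩ P ⁻¹' {i}
  · obtain ⟨i, M, hM, hMi⟩ := hex
    obtain ⟨j, hjh, hj, hj'⟩ := exists_max_packs (hfib i)
    have hj1 : 1 ≤ j := by
      by_contra h0
      obtain rfl : j = 0 := by omega
      exact hj' (packs_one hM hMi)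
    have hdisj : Disjoint (U ∩ P ⁻¹' {i}) (U \ P ⁻¹' {i}) :=
      Set.disjoint_left.2 fun x hx hx' => hx'.2 hx.2
    have hjm : j ≤ m := by
      by_contra hlt
      exact hm (hj.mono Set.inter_subset_left (by omega))
    have hrest : ¬ Packs MM (U \ P ⁻¹' {i}) (m - j + 1) := fun hp => hm
      ((hj.union hp hdisj).mono (Set.union_subset Set.inter_subset_left Set.sdiff_subset)
        (by omega))
    obtain ⟨X₁, hX₁, hX₁M⟩ := hcov j hjh _ Set.inter_subset_left hj'
    obtain ⟨X₂, hX₂, hX₂M⟩ := ih (m - j) (by omega) (U := U \ P ⁻¹' {i})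
      (fun j hj W hW => hcov j hj W (hW.trans Set.sdiff_subset))
      (fun i' hp => hfib i' (hp.mono (Set.inter_subset_inter_left _ Set.sdiff_subset) le_rfl))
      hrest
    refine ⟨X₁ ∪ X₂, ?_, fun i' M' hM' hM'i => ?_⟩
    · refine (Finset.card_union_le _ _).trans ?_
      -- With `j ≤ h` the cost of a fibre becomes linear in its packing number, so the costs of the
      -- fibres add up.
      have h1 : C * j ^ (q + 1) ≤ C * h ^ q * j := by
        rw [pow_succ, ← mul_assoc]
        gcongr
      have h2 : C * h ^ q * m = C * h ^ q * j + C * h ^ q * (m - j) := by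
        rw [← mul_add, Nat.add_sub_cancel' hjm]
      omega
    · by_cases hii : i' = i
      · subst hii
        obtain ⟨x, hx, hxX⟩ := hX₁M M' hM' hM'i
        exact ⟨x, hx, Finset.mem_union_left _ hxX⟩
      · obtain ⟨x, hx, hxX⟩ := hX₂M i' M' hM' fun x hx =>
          ⟨⟨(hM'i hx).1, fun h' => hii ((hM'i hx).2.symm.trans h')⟩, (hM'i hx).2⟩
        exact ⟨x, hx, Finset.mem_union_right _ hxX⟩
  · push Not at hex
    exact ⟨∅, by simp, fun i M hM hMi => absurd hMi (hex i M hM)⟩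

/-- If every set without `k + 1` disjoint members of a family can be split cheaply into pieces
containing at most `k / 2` disjoint members each, then the family has the Erdős–Pósa property. -/
theorem exists_hitting_of_split {ι : Type*} {c q : ℕ} (hq : 1 ≤ q) {U₀ : Set γ}
    (hsplit : ∀ k, 1 ≤ k → ∀ U ⊆ U₀, ¬ Packs MM U (k + 1) →
      ∃ (X : Finset γ) (P : γ → ι), X.card ≤ c * k ^ (q + 1) ∧
        (∀ M ∈ MM, M ⊆ U \ X → ∃ i, ∃ M' ∈ MM, M' ⊆ M ∩ P ⁻¹' {i}) ∧
        ∀ i, ¬ Packs MM ((U \ X) ∩ P ⁻¹' {i}) (k / 2 + 1))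
    (hU : U ⊆ U₀) (hk : ¬ Packs MM U (k + 1)) :
    ∃ X : Finset γ, X.card ≤ 2 * c * k ^ (q + 1) ∧ ∀ M ∈ MM, M ⊆ U → ∃ x ∈ M, x ∈ X := by
  classical
  induction k using Nat.strong_induction_on generalizing U with
  | _ k ih =>
  rcases Nat.eq_zero_or_pos k with rfl | hpos
  · exact ⟨∅, by simp, fun M hM hMU => absurd (packs_one hM hMU) hk⟩
  · obtain ⟨X, P, hX, hXM, hfib⟩ := hsplit k hpos U hU hk
    obtain ⟨Y, hY, hYM⟩ := exists_hitting_of_fibres P (h := k / 2) (q := q) (C := 2 * c)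
      (fun j hj W hW hp => ih j (by omega) ((hW.trans Set.sdiff_subset).trans hU) hp) hfib
      (fun hp => hk (hp.mono Set.sdiff_subset le_rfl))
    refine ⟨X ∪ Y, ?_, fun M hM hMU => ?_⟩
    · refine (Finset.card_union_le _ _).trans ?_
      -- Here `q ≥ 1` enters: halving saves a factor of at least 2, so hitting the pieces costs no
      -- more than the split itself.
      have h1 : 2 * (k / 2) ^ q ≤ k ^ q := by
        calc 2 * (k / 2) ^ q ≤ 2 ^ q * (k / 2) ^ q := by
              gcongr
              exact Nat.le_self_pow (by omega) 2
          _ = (2 * (k / 2)) ^ q := (mul_pow _ _ _).symm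
          _ ≤ k ^ q := by
              gcongr
              omega
      have h2 : 2 * c * (k / 2) ^ q * k ≤ c * k ^ (q + 1) := by
        calc 2 * c * (k / 2) ^ q * k = c * (2 * (k / 2) ^ q) * k := by ring
          _ ≤ c * k ^ q * k := by gcongr
          _ = c * k ^ (q + 1) := by ring
      have h3 : 2 * c * k ^ (q + 1) = c * k ^ (q + 1) + c * k ^ (q + 1) := by ring
      omega
    · by_cases hMX : ∃ x ∈ M, x ∈ X
      · obtain ⟨x, hx, hxX⟩ := hMX
        exact ⟨x, hx, Finset.mem_union_left _ hxX⟩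
      · push Not at hMX
        have hMUX : M ⊆ U \ X := fun x hx => ⟨hMU hx, hMX x hx⟩
        obtain ⟨i, M', hM', hM'M⟩ := hXM M hM hMUX
        obtain ⟨x, hx, hxY⟩ := hYM i M' hM' fun x hx => ⟨hMUX (hM'M hx).1, (hM'M hx).2⟩
        exact ⟨x, (hM'M hx).1, Finset.mem_union_right _ hxY⟩

end AbstractGap

/-! ### Cutting claw-free graphs into connected heavy pieces. -/

section ClawFree

variable {β : Type*} {R : β → β → Prop}

/-- The piece `F₁` hangs on the rest through `e`. Removing `e` leaves components all adjacent to
`e`, hence at most two by claw-freeness. A heavy component replaces `F₁`, since everything else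
stays connected through `e`; if none is heavy, `F₁` has at most `1 + 2 * (r - 1)` elements in `L`
and is itself the answer. -/
theorem exists_heavy_piece (hR : ∀ x y, R x y → R y x)
    (hclaw : ∀ e f g h, R e f → R e g → R e h → R f g ∨ R f h ∨ R g h) {F L : Set β}
    (hF : F.Finite) {r : ℕ} (hr : 1 ≤ r) {F₁ : Set β} (h₁ : F₁ ⊆ F) (hc : Conn R F₁)
    (hrest : ∃ e ∈ F₁, ∀ x ∈ F \ F₁, Joined R (insert e (F \ F₁)) e x)
    (hpre : ∀ x ∈ F \ F₁, ∀ y ∈ F \ F₁, Joined R (F \ F₁) x y) (hL : r ≤ (F₁ ∩ L).ncard) :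
    ∃ C ⊆ F, Conn R C ∧ r ≤ (C ∩ L).ncard ∧ (C ∩ L).ncard < 2 * r ∧
      ∀ x ∈ F \ C, ∀ y ∈ F \ C, Joined R (F \ C) x y := by
  induction hn : F₁.ncard using Nat.strong_induction_on generalizing F₁ with
  | _ n ih =>
  obtain ⟨e, he, heJ⟩ := hrest
  set c : β → Set β := fun f => {g | Joined R (F₁ \ {e}) f g} with hcdef
  have hcsub : ∀ f ∈ F₁ \ {e}, c f ⊆ F₁ \ {e} := fun f hf g hg => Joined.right_mem hg hf
  have hnb : ∀ f ∈ F₁ \ {e}, ∃ g ∈ c f, R g e := by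
    intro f hf
    obtain ⟨u, hu, w, hw, huw, huF, hwF⟩ := (hc.2 f hf.1 e he).exists_exit (W := c f) (.refl f)
      (fun h => (hcsub f hf h).2 rfl)
    have hwe : w = e := by
      by_contra hwe
      exact hw (Joined.trans hu (.single huw (hcsub f hf hu) ⟨hwF, hwe⟩))
    exact ⟨u, hu, hwe ▸ huw⟩
  have hadj : ∀ f ∈ F₁ \ {e}, ∀ g ∈ F₁ \ {e}, ∀ x ∈ c f, ∀ y ∈ c g, R x y → g ∈ c f :=
    fun f hf g hg x hx y hy hxy => (Joined.trans hx (.single hxy (hcsub f hf hx)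
      (hcsub g hg hy))).trans (Joined.symm hR hy)
  have hfinc : ∀ f ∈ F₁ \ {e}, (c f ∩ L).Finite := fun f hf =>
    hF.subset fun x hx => h₁ (hcsub f hf hx.1).1
  by_cases hheavy : ∃ f ∈ F₁ \ {e}, r ≤ (c f ∩ L).ncard
  · obtain ⟨f, hf, hfr⟩ := hheavy
    have heF : e ∈ F \ c f := ⟨h₁ he, fun h => (hcsub f hf h).2 rfl⟩
    have key : ∀ x ∈ F \ c f, Joined R (F \ c f) e x := by
      rintro x ⟨hxF, hxc⟩
      by_cases hx1 : x ∈ F₁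
      · by_cases hxe : x = e
        · rw [hxe]; exact .refl _
        · have hx : x ∈ F₁ \ {e} := ⟨hx1, hxe⟩
          have hsub : c x ⊆ F \ c f := fun y hy => ⟨h₁ (hcsub x hx hy).1,
            fun h => hxc (Joined.trans h (Joined.symm hR hy))⟩
          obtain ⟨y, hy, hye⟩ := hnb x hx
          exact (Joined.single (hR _ _ hye) heF (hsub hy)).trans
            (((Joined.within hy).mono_set hsub).symm hR)
      · refine (heJ x ⟨hxF, hx1⟩).mono_set ?_
        rintro y (rfl | hy)
        exacts [heF, ⟨hy.1, fun h => hy.2 (hcsub f hf h).1⟩]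
    refine ih _ ?_ (F₁ := c f) (fun x hx => h₁ (hcsub f hf hx).1) (conn_joined hR f) ?_ ?_ hfr rfl
    · rw [← hn]
      exact Set.ncard_lt_ncard ⟨fun x hx => (hcsub f hf hx).1,
        fun h => (hcsub f hf (h he)).2 rfl⟩ (hF.subset h₁)
    · obtain ⟨g, hg, hge⟩ := hnb f hf
      exact ⟨g, hg, fun x hx => (Joined.single hge (.inl rfl) (.inr heF)).trans
        ((key x hx).mono_set (Set.subset_insert _ _))⟩
    · exact fun x hx y hy => ((key x hx).symm hR).trans (key y hy)
  · push Not at hheavy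
    refine ⟨F₁, h₁, hc, hL, ?_, fun x hx y hy => ?_⟩
    · have hone : ({e} : Set β).ncard = 1 := Set.ncard_singleton e
      by_cases hcov : ∃ f ∈ F₁ \ {e}, ∃ g ∈ F₁ \ {e}, g ∉ c f
      · obtain ⟨f, hf, g, hg, hgf⟩ := hcov
        have hsub : F₁ ∩ L ⊆ {e} ∪ ((c f ∩ L) ∪ (c g ∩ L)) := by
          rintro x ⟨hx, hxL⟩
          by_cases hxe : x = e
          · exact .inl hxe
          · right
            have hx' : x ∈ F₁ \ {e} := ⟨hx, hxe⟩
            by_contra hcon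
            have hxf : x ∉ c f := fun h => hcon (.inl ⟨h, hxL⟩)
            have hxg : x ∉ c g := fun h => hcon (.inr ⟨h, hxL⟩)
            obtain ⟨f', hf', hfe⟩ := hnb f hf
            obtain ⟨g', hg', hge⟩ := hnb g hg
            obtain ⟨x', hx'', hxe'⟩ := hnb x hx'
            rcases hclaw e f' g' x' (hR _ _ hfe) (hR _ _ hge) (hR _ _ hxe') with h | h | h
            · exact hgf (hadj f hf g hg f' hf' g' hg' h)
            · exact hxf (hadj f hf x hx' f' hf' x' hx'' h)
            · exact hxg (hadj g hg x hx' g' hg' x' hx'' h)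
        have h1 := Set.ncard_le_ncard hsub
          ((Set.finite_singleton e).union ((hfinc f hf).union (hfinc g hg)))
        have h2 := Set.ncard_union_le {e} ((c f ∩ L) ∪ (c g ∩ L))
        have h3 := Set.ncard_union_le (c f ∩ L) (c g ∩ L)
        have h4 := hheavy f hf
        have h5 := hheavy g hg
        omega
      · push Not at hcov
        by_cases hne : ∃ f, f ∈ F₁ \ {e}
        · obtain ⟨f, hf⟩ := hne
          have hsub : F₁ ∩ L ⊆ {e} ∪ (c f ∩ L) := by
            rintro x ⟨hx, hxL⟩
            by_cases hxe : x = e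
            · exact .inl hxe
            · exact .inr ⟨hcov f hf x ⟨hx, hxe⟩, hxL⟩
          have h1 := Set.ncard_le_ncard hsub ((Set.finite_singleton e).union (hfinc f hf))
          have h2 := Set.ncard_union_le {e} (c f ∩ L)
          have h4 := hheavy f hf
          omega
        · have hsub : F₁ ∩ L ⊆ {e} := by
            rintro x ⟨hx, -⟩
            by_contra hxe
            exact hne ⟨x, hx, hxe⟩
          have h1 := Set.ncard_le_ncard hsub (Set.finite_singleton e)
          omega
    · exact hpre x hx y hy

/-- A finite connected claw-free graph splits into many disjoint connected heavy sets. -/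
theorem exists_disjoint_heavy_pieces (hR : ∀ x y, R x y → R y x)
    (hclaw : ∀ e f g h, R e f → R e g → R e h → R f g ∨ R f h ∨ R g h) {F L : Set β}
    (hF : F.Finite) {r : ℕ} (hr : 1 ≤ r) (hc : ∀ x ∈ F, ∀ y ∈ F, Joined R F x y) {K : ℕ}
    (hL : 2 * r * K ≤ (F ∩ L).ncard) :
    ∃ C : Fin K → Set β, (∀ i, C i ⊆ F ∧ Conn R (C i) ∧ r ≤ (C i ∩ L).ncard) ∧
      ∀ i j, i ≠ j → Disjoint (C i) (C j) := by
  induction K generalizing F with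
  | zero => exact ⟨fun i => i.elim0, fun i => i.elim0, fun i => i.elim0⟩
  | succ K ih =>
    rw [mul_add, mul_one] at hL
    obtain ⟨e, he⟩ : F.Nonempty := by
      by_contra hne
      rw [Set.not_nonempty_iff_eq_empty.1 hne, Set.empty_inter, Set.ncard_empty] at hL
      omega
    obtain ⟨C, hCF, hC, hCr, hCr', hrest⟩ := exists_heavy_piece (L := L) hR hclaw hF hr
      (subset_refl F) ⟨⟨e, he⟩, hc⟩ ⟨e, he, fun x hx => absurd hx.1 hx.2⟩
      (fun x hx => absurd hx.1 hx.2) (by omega)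
    obtain ⟨D, hD, hDd⟩ := ih (F := F \ C) (hF.subset Set.sdiff_subset) hrest (by
      have h1 := Set.ncard_le_ncard (show F ∩ L ⊆ (C ∩ L) ∪ ((F \ C) ∩ L) from fun x hx => by
        by_cases h : x ∈ C
        exacts [.inl ⟨h, hx.2⟩, .inr ⟨⟨hx.1, h⟩, hx.2⟩])
        (hF.subset (Set.union_subset (Set.inter_subset_left.trans hCF)
          (Set.inter_subset_left.trans Set.sdiff_subset)))
      have h2 := Set.ncard_union_le (C ∩ L) ((F \ C) ∩ L)
      omega)
    have hCD : ∀ i, Disjoint C (D i) := fun i =>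
      Set.disjoint_left.2 fun x hx hx' => ((hD i).1 hx').2 hx
    refine ⟨Fin.cons C D, fun i => ?_, fun i j => ?_⟩
    · refine Fin.cases ?_ (fun i => ?_) i
      · exact ⟨hCF, hC, hCr⟩
      · exact ⟨(hD i).1.trans Set.sdiff_subset, (hD i).2⟩
    · refine Fin.cases ?_ (fun i => ?_) i <;> refine Fin.cases ?_ (fun j => ?_) j <;>
        simp only [Fin.cons_zero, Fin.cons_succ] <;> intro hij
      · exact absurd rfl hij
      · exact hCD j
      · exact (hCD i).symm
      · exact hDd i j fun h => hij (by rw [h])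

end ClawFree
-- Models as pairs of connected sets, and the vertex bound.
section Theta

variable {α : Type u} {β : Type v} {G : Graph α β} {F F' U : Set β} {r : ℕ} {A B D : Set α}

/-- Adjacency by means of an edge in `F`. -/
def adjE (G : Graph α β) (F : Set β) (x y : α) : Prop := ∃ e ∈ F, G.IsLink e x y

/-- `A` and `B` are disjoint, connected in the graph with edge set `F`, and at least `r` edges
in `F` join `A` to `B`. -/
structure Theta (G : Graph α β) (F : Set β) (r : ℕ) (A B : Set α) : Prop where
  disj : Disjoint A B
  left : Conn (adjE G F) A
  right : Conn (adjE G F) B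
  le_encard : (r : ℕ∞) ≤ {e | e ∈ F ∧ ∃ x ∈ A, ∃ y ∈ B, G.IsLink e x y}.encard

/-- The edges in `F` with both ends in `b`. -/
def inner (G : Graph α β) (F : Set β) (b : Set α) : Set β :=
  {e | e ∈ F ∧ ∃ x ∈ b, ∃ y ∈ b, G.IsLink e x y}

/-- The edges in `F` with at least one end in `D`. -/
def touching (G : Graph α β) (F : Set β) (D : Set α) : Set β :=
  {e | e ∈ F ∧ ∃ x ∈ D, G.Inc e x}

theorem adjE_symm (G : Graph α β) (F : Set β) (x y : α) (h : adjE G F x y) : adjE G F y x := by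
  obtain ⟨e, he, h⟩ := h
  exact ⟨e, he, h.symm⟩

theorem finite_adjE (hV : G.vertexSet.Finite) (F : Set β) :
    {p : α × α | adjE G F p.1 p.2}.Finite :=
  (hV.prod hV).subset fun _ ⟨_, _, h⟩ => ⟨h.left_mem, h.right_mem⟩

theorem adjE.mono {x y : α} (h : adjE G F x y) (hF : F ⊆ F') : adjE G F' x y := by
  obtain ⟨e, he, h⟩ := h
  exact ⟨e, hF he, h⟩

theorem Theta.exists_link (h : Theta G F r A B) (hr : 1 ≤ r) :
    ∃ e ∈ F, ∃ x ∈ A, ∃ y ∈ B, G.IsLink e x y := by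
  have hne : {e | e ∈ F ∧ ∃ x ∈ A, ∃ y ∈ B, G.IsLink e x y}.Nonempty := by
    rw [← Set.encard_pos]
    exact lt_of_lt_of_le (by exact_mod_cast hr) h.le_encard
  obtain ⟨e, he, h⟩ := hne
  exact ⟨e, he, h⟩

theorem Theta.symm (h : Theta G F r A B) : Theta G F r B A := by
  refine ⟨h.disj.symm, h.right, h.left, h.le_encard.trans (Set.encard_le_encard ?_)⟩
  rintro e ⟨he, x, hx, y, hy, hl⟩
  exact ⟨he, y, hy, x, hx, hl.symm⟩

theorem Theta.mono (h : Theta G F r A B) (hF : F ⊆ F') : Theta G F' r A B := by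
  refine ⟨h.disj, h.left.mono fun _ _ _ _ h => h.mono hF, h.right.mono fun _ _ _ _ h => h.mono hF,
    h.le_encard.trans (Set.encard_le_encard ?_)⟩
  rintro e ⟨he, h⟩
  exact ⟨hF he, h⟩

theorem Theta.restrict (h : Theta G F r A B) (hF : ∀ e ∈ F, ∀ x ∈ A ∪ B, ∀ y ∈ A ∪ B,
    G.IsLink e x y → e ∈ F') : Theta G F' r A B := by
  refine ⟨h.disj, h.left.mono ?_, h.right.mono ?_, h.le_encard.trans (Set.encard_le_encard ?_)⟩
  · rintro x hx y hy ⟨e, he, hl⟩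
    exact ⟨e, hF e he x (.inl hx) y (.inl hy) hl, hl⟩
  · rintro x hx y hy ⟨e, he, hl⟩
    exact ⟨e, hF e he x (.inr hx) y (.inr hy) hl, hl⟩
  · rintro e ⟨he, x, hx, y, hy, hl⟩
    exact ⟨hF e he x (.inl hx) y (.inr hy) hl, x, hx, y, hy, hl⟩

theorem Theta.inner (h : Theta G F r A B) : Theta G (inner G F (A ∪ B)) r A B :=
  h.restrict fun _ he x hx y hy hl => ⟨he, x, hx, y, hy, hl⟩

theorem Theta.conn_union (h : Theta G F r A B) (hr : 1 ≤ r) : Conn (adjE G F) (A ∪ B) := by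
  obtain ⟨e, he, x, hx, y, hy, hl⟩ := h.exists_link hr
  exact h.left.union (adjE_symm G F) h.right ⟨x, hx, y, hy, .inr ⟨e, he, hl⟩⟩

theorem Conn.subset_of_mem {R : α → α → Prop} {W : Set α} (h : Conn R A)
    (hR : ∀ x y, R x y → y ∈ W) {a : α} (ha : a ∈ A) (haW : a ∈ W) : A ⊆ W := by
  intro b hb
  rcases Relation.ReflTransGen.cases_tail (h.2 a ha b hb) with h | ⟨c, -, h⟩
  · exact h ▸ haW
  · exact hR _ _ h.1

/-- As `r ≥ 1` there is a cross edge, so `A ∪ B` is connected and contains an end of an edge; even a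
one-point side is covered by the ends of edges. -/
theorem Theta.union_subset (h : Theta G F r A B) (hr : 1 ≤ r) {W : Set α}
    (hW : ∀ x y, adjE G F x y → y ∈ W) : A ∪ B ⊆ W := by
  obtain ⟨e, he, x, hx, y, hy, hl⟩ := h.exists_link hr
  exact (h.conn_union hr).subset_of_mem hW (.inr hy) (hW x y ⟨e, he, hl⟩)

theorem adjE_inner {b : Set α} {x y : α} (h : adjE G (inner G F b) x y) : x ∈ b ∧ y ∈ b := by
  obtain ⟨e, ⟨-, x', hx', y', hy', h'⟩, h⟩ := h
  rcases h.eq_and_eq_or_eq_and_eq h' with ⟨rfl, rfl⟩ | ⟨rfl, rfl⟩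
  exacts [⟨hx', hy'⟩, ⟨hy', hx'⟩]

theorem disjoint_inner {b b' : Set α} (h : Disjoint b b') :
    Disjoint (inner G F b) (inner G F b') := by
  rw [Set.disjoint_left]
  rintro e ⟨-, x, hx, y, hy, hl⟩ ⟨-, x', hx', y', hy', hl'⟩
  rcases hl.left_eq_or_eq hl' with rfl | rfl
  exacts [Set.disjoint_left.1 h hx hx', Set.disjoint_left.1 h hx hy']

/-- A bramble of large order yields many disjoint pairs as in the definition of `Theta`. -/
theorem exists_disjoint_theta (hV : G.vertexSet.Finite) {BB : Set (Set α)}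
    (hBV : ∀ b ∈ BB, b ⊆ G.vertexSet) (hconn : ∀ b ∈ BB, Conn (adjE G F) b)
    (hint : ∀ b ∈ BB, ∀ b' ∈ BB, (b ∩ b').Nonempty) {K : ℕ} (hK : 1 ≤ K) (hr : 1 ≤ r)
    (hhit : ∀ Y : Finset α, Y.card < 2 * (K * (K * r)) → ∃ b ∈ BB, ∀ x ∈ Y, x ∉ b) :
    ∃ A B : Fin K → Set α, (∀ i, Theta G F r (A i) (B i)) ∧
      ∀ i j, i ≠ j → Disjoint (A i ∪ B i) (A j ∪ B j) := by
  obtain ⟨A, B, hAB, hd, hd'⟩ := exists_disjoint_linked_pairs (adjE_symm G F) (finite_adjE hV F)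
    hV hBV hconn hint hK hr hhit
  refine ⟨A, B, fun i => ⟨hd i i, (hAB i).1, (hAB i).2.1, ?_⟩, fun i j hij => ?_⟩
  · obtain ⟨-, -, f, g, hf, hfg⟩ := hAB i
    choose hfA hgB e he hl using hfg
    have hinj : Function.Injective e := by
      intro j j' h
      have h1 := hl j
      rw [h] at h1
      rcases h1.left_eq_or_eq (hl j') with h2 | h2
      · exact hf h2
      · exact absurd (h2 ▸ hgB j') (Set.disjoint_left.1 (hd i i) (hfA j))
    calc (r : ℕ∞) ≤ (Set.range e).encard := by simpa using hinj.encard_range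
      _ ≤ _ := Set.encard_le_encard (by
        rintro _ ⟨j, rfl⟩
        exact ⟨he j, f j, hfA j, g j, hgB j, hl j⟩)
  · rw [Set.disjoint_union_left, Set.disjoint_union_right, Set.disjoint_union_right]
    exact ⟨⟨(hd' i j hij).1, hd i j⟩, (hd j i).symm, (hd' i j hij).2⟩

/-- The component of `v` inside `U`. -/
def comp (R : α → α → Prop) (U : Set α) (v : α) : Set α := {w | Joined R U v w}

theorem comp_eq {R : α → α → Prop} (hR : ∀ x y, R x y → R y x) {U : Set α} {x y : α}
    (h : Joined R U x y) : comp R U x = comp R U y :=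
  Set.ext fun _ => ⟨fun h' => (h.symm hR).trans h', fun h' => h.trans h'⟩

theorem mem_of_comp_eq {R : α → α → Prop} {U : Set α} {x y : α}
    (h : comp R U x = comp R U y) : Joined R U x y := by
  have h' : y ∈ comp R U y := Joined.refl y
  rwa [← h] at h'

/-- The vertex sets of the models given by `Theta`. -/
def vertexModels (G : Graph α β) (r : ℕ) : Set (Set α) :=
  {M | ∃ A B, Theta G Set.univ r A B ∧ M = A ∪ B}

/-- The edge sets containing the edges of a model given by `Theta`. -/
def edgeModels (G : Graph α β) (r : ℕ) : Set (Set β) :=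
  {M | ∃ A B, Theta G M r A B}

theorem card_bound {k r n : ℕ} (hk : 1 ≤ k) (hn : n < 2 * ((k + 1) * ((k + 1) * r))) :
    n ≤ 8 * r * k ^ 2 := by
  have h : 2 * ((k + 1) * ((k + 1) * r)) ≤ 2 * ((2 * k) * ((2 * k) * r)) := by
    gcongr <;> omega
  have h' : 2 * ((2 * k) * ((2 * k) * r)) = 8 * r * k ^ 2 := by ring
  omega

/-- The members of `BB` are the connected parts of `U` packing more than `k / 2`. They pairwise
intersect because `2 * (k / 2 + 1) ≥ k + 1`. The bramble theorem supplies a small `Y` meeting all of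
them, so no component of `U \ Y` belongs to `BB`. -/
theorem exists_vertex_hitting (hV : G.vertexSet.Finite) (hr : 1 ≤ r) {k : ℕ}
    (hk : ¬ Packs (vertexModels G r) G.vertexSet (k + 1)) :
    ∃ X : Finset α, X.card ≤ 2 * (8 * r) * k ^ 2 ∧
      ∀ M ∈ vertexModels G r, M ⊆ G.vertexSet → ∃ x ∈ M, x ∈ X := by
  refine exists_hitting_of_split (ι := Set α) (q := 1) le_rfl (U₀ := G.vertexSet)
    (fun k hk1 U hU hk => ?_) subset_rfl hk
  set F : Set β := inner G Set.univ U with hF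
  set BB : Set (Set α) := {b | b ⊆ U ∧ Conn (adjE G F) b ∧
    Packs (vertexModels G r) b (k / 2 + 1)} with hBB
  have hY : ∃ Y : Finset α, Y.card < 2 * ((k + 1) * ((k + 1) * r)) ∧ ∀ b ∈ BB, ∃ x ∈ Y, x ∈ b := by
    by_contra! hcon
    obtain ⟨A, B, hAB, hd⟩ := exists_disjoint_theta hV (F := F) (BB := BB)
      (fun b hb => hb.1.trans hU) (fun b hb => hb.2.1) (fun b hb b' hb' => by
        by_contra hne
        refine hk ((hb.2.2.union hb'.2.2 ?_).mono (Set.union_subset hb.1 hb'.1) (by omega))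
        exact Set.disjoint_iff_inter_eq_empty.2 (Set.not_nonempty_iff_eq_empty.1 hne))
      (Nat.succ_pos k) hr hcon
    exact hk ⟨fun i => A i ∪ B i, fun i => ⟨⟨A i, B i, (hAB i).mono (Set.subset_univ _), rfl⟩,
      (hAB i).union_subset hr fun _ _ h => (adjE_inner h).2⟩, hd⟩
  obtain ⟨Y, hYc, hY⟩ := hY
  have hsymm := adjE_symm G (Set.univ : Set β)
  refine ⟨Y, comp (adjE G Set.univ) (U \ Y), card_bound hk1 hYc, ?_, fun i hp => ?_⟩
  · rintro M ⟨A, B, hAB, rfl⟩ hMU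
    obtain ⟨x, hx⟩ := (hAB.conn_union hr).1
    exact ⟨_, _, ⟨A, B, hAB, rfl⟩, fun z hz => ⟨hz,
      (comp_eq hsymm (((hAB.conn_union hr).2 x hx z hz).mono_set hMU)).symm⟩⟩
  · obtain ⟨M, ⟨A, B, hAB, rfl⟩, hM⟩ := hp.exists_mem (by omega)
    obtain ⟨x, hx⟩ := (hAB.conn_union hr).1
    have hxS := hM hx
    have hc : Conn (adjE G Set.univ) ((U \ ↑Y) ∩ comp (adjE G Set.univ) (U \ ↑Y) ⁻¹' {i}) := by
      refine ⟨⟨x, hxS⟩, fun a ha b hb => ?_⟩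
      have hab : Joined (adjE G Set.univ) (U \ ↑Y) a b := mem_of_comp_eq (ha.2.trans hb.2.symm)
      refine (Joined.within hab).mono_set fun z hz => ⟨Joined.right_mem hz ha.1, ?_⟩
      exact (comp_eq hsymm hz).symm.trans ha.2
    obtain ⟨y, hyY, hyb⟩ := hY _ ⟨fun z hz => hz.1.1,
      hc.mono fun a ha b hb ⟨e, he, hl⟩ => ⟨e, ⟨he, a, ha.1.1, b, hb.1.1, hl⟩, hl⟩, hp⟩
    exact hyb.1.2 hyY

end Theta
-- The edge bound: splitting at a cut vertex or deleting small edge stars.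
section EdgeVersion

variable {α : Type u} {β : Type v} {G : Graph α β} {F F' U : Set β} {r : ℕ} {A B D : Set α}

/-- The set of vertices reachable in `W` from the ends of the edge `e` in `W`. -/
def edgeComp (G : Graph α β) (U : Set β) (W : Set α) (e : β) : Set α :=
  {w | ∃ z ∈ W, G.Inc e z ∧ Joined (adjE G U) W z w}

/-- Two ends of an edge of `U` that both lie in `W` are joined by that edge, so either one
determines the component. -/
theorem edgeComp_eq {W : Set α} {e : β} {z : α} (he : e ∈ U) (hz : z ∈ W) (hez : G.Inc e z) :
    edgeComp G U W e = comp (adjE G U) W z := by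
  ext w
  refine ⟨?_, fun h => ⟨z, hz, hez, h⟩⟩
  rintro ⟨z', hz', hez', h⟩
  obtain ⟨y, hl⟩ := hez
  rcases hez'.eq_or_eq_of_isLink hl with rfl | rfl
  · exact h
  · exact (Joined.single ⟨e, he, hl⟩ hz hz').trans h

/-- Edges at `v` into a component of the rest of the graph. -/
def starEdges (G : Graph α β) (U : Set β) (v : α) (D : Set α) : Set β :=
  {e | e ∈ U ∧ ∃ d ∈ D, G.IsLink e v d}

/-- A vertex sending many edges into a connected set of other vertices produces many
edge-disjoint models. -/
theorem packs_of_starEdges (hE : G.edgeSet.Finite) (hr : 1 ≤ r) {v z : α} (hz : z ≠ v) {K : ℕ}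
    (hK : 2 * r * K ≤ (starEdges G U v (comp (adjE G U) {v}ᶜ z)).ncard) :
    Packs (edgeModels G r) U K := by
  set D := comp (adjE G U) {v}ᶜ z with hD
  have hDv : ∀ d ∈ D, d ≠ v := fun d hd => Joined.right_mem (U := {v}ᶜ) hd hz
  set F := touching G U D with hF
  -- Edges are adjacent when they share an end other than `v`. An edge has at most two ends, so two
  -- of any three neighbours meet it at the same end: no claws. Each heavy piece gives a model with
  -- sides `{v}` and its remaining vertices.
  set R : β → β → Prop := fun e f => ∃ w, w ≠ v ∧ G.Inc e w ∧ G.Inc f w with hRdef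
  have hR : ∀ e f, R e f → R f e := fun e f ⟨w, h1, h2, h3⟩ => ⟨w, h1, h3, h2⟩
  have hclaw : ∀ e f g h, R e f → R e g → R e h → R f g ∨ R f h ∨ R g h := by
    rintro e f g h ⟨a, ha, hea, hfa⟩ ⟨b, hb, heb, hgb⟩ ⟨c, hc, hec, hhc⟩
    rcases hea.eq_or_eq_or_eq heb hec with rfl | rfl | rfl
    · exact .inl ⟨_, ha, hfa, hgb⟩
    · exact .inr (.inl ⟨_, ha, hfa, hhc⟩)
    · exact .inr (.inr ⟨_, hb, hgb, hhc⟩)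
  have hFfin : F.Finite := hE.subset fun e he => by
    obtain ⟨-, x, -, hx⟩ := he
    exact hx.edge_mem
  have hconn : ∀ x₀ ∈ D, ∀ x, Joined (adjE G U) {v}ᶜ x₀ x → ∀ e ∈ F, G.Inc e x₀ →
      ∀ f ∈ F, G.Inc f x → Joined R F e f := by
    intro x₀ hx₀ x hx
    induction hx with
    | refl => exact fun e he hez f hf hfz => .single ⟨x₀, hDv _ hx₀, hez, hfz⟩ he hf
    | @tail x y hx hs ih =>
      intro e he hez f hf hfy
      obtain ⟨⟨g, hgU, hg⟩, hxv, hyv⟩ := hs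
      have hgF : g ∈ F := ⟨hgU, x, Joined.trans hx₀ hx, hg.inc_left⟩
      exact (ih e he hez g hgF hg.inc_left).trans (.single ⟨y, hyv, hg.inc_right, hfy⟩ hgF hf)
  have hFconn : ∀ e ∈ F, ∀ f ∈ F, Joined R F e f := by
    intro e he f hf
    obtain ⟨-, x, hx, hex⟩ := id he
    obtain ⟨-, y, hy, hfy⟩ := id hf
    exact hconn x hx y ((Joined.symm (adjE_symm G U) hx).trans hy) e he hex f hf hfy
  have hstar : starEdges G U v D ⊆ F := fun e ⟨he, d, hd, hl⟩ => ⟨he, d, hd, hl.inc_right⟩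
  obtain ⟨C, hC, hCd⟩ := exists_disjoint_heavy_pieces (L := starEdges G U v D) hR hclaw hFfin hr
    hFconn (by rwa [Set.inter_eq_right.2 hstar])
  refine ⟨C, fun i => ⟨?_, (hC i).1.trans fun e he => he.1⟩, hCd⟩
  obtain ⟨hCF, hCc, hCr⟩ := hC i
  set B : Set α := {w | w ≠ v ∧ ∃ e ∈ C i, G.Inc e w} with hB
  have hCL : (C i ∩ starEdges G U v D).Finite := hFfin.subset (Set.inter_subset_left.trans hCF)
  refine ⟨{v}, B, ?_, .singleton v, ?_, ?_⟩
  · rw [Set.disjoint_singleton_left]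
    exact fun h => h.1 rfl
  · have key : ∀ e ∈ C i, ∀ w, w ≠ v → G.Inc e w → ∀ f, Joined R (C i) e f → ∀ w', w' ≠ v →
        G.Inc f w' → Joined (adjE G (C i)) B w w' := by
      intro e he w hw hew f hf
      have same : ∀ g ∈ C i, ∀ x, x ≠ v → G.Inc g x → ∀ y, y ≠ v → G.Inc g y →
          Joined (adjE G (C i)) B x y := by
        rintro g hg x hx ⟨x', hl⟩ y hy hgy
        rcases hgy.eq_or_eq_of_isLink hl with rfl | rfl
        · exact .refl _
        · exact .single ⟨g, hg, hl⟩ ⟨hx, g, hg, hl.inc_left⟩ ⟨hy, g, hg, hl.inc_right⟩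
      induction hf with
      | refl => exact fun w' hw' hew' => same e he w hw hew w' hw' hew'
      | @tail f g hf hs ih =>
        intro w' hw' hgw'
        obtain ⟨⟨y, hy, hfy, hgy⟩, -, hg⟩ := hs
        exact (ih y hy hfy).trans (same g hg y hy hgy w' hw' hgw')
    refine ⟨?_, fun x ⟨hx, e, he, hex⟩ y ⟨hy, f, hf, hfy⟩ =>
      key e he x hx hex f (hCc.2 e he f hf) y hy hfy⟩
    obtain ⟨e, he⟩ := hCc.1
    obtain ⟨-, x, hx, hex⟩ := hCF he
    exact ⟨x, hDv x hx, e, he, hex⟩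
  · calc (r : ℕ∞) ≤ ((C i ∩ starEdges G U v D).ncard : ℕ∞) := by exact_mod_cast hCr
      _ = (C i ∩ starEdges G U v D).encard := hCL.cast_ncard_eq
      _ ≤ _ := Set.encard_le_encard (by
        rintro e ⟨heC, -, d, hd, hl⟩
        exact ⟨heC, v, rfl, d, ⟨hDv d hd, e, heC, hl.inc_right⟩, hl⟩)

theorem conn_of_avoid {v z s : α} {M : Set β} (hMU : M ⊆ U) {S : Set α} (hS : Conn (adjE G M) S)
    (hv : v ∉ S) (hs : s ∈ S) (hzs : Joined (adjE G U) {v}ᶜ z s) :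
    (∀ x ∈ S, Joined (adjE G U) {v}ᶜ z x) ∧
      Conn (adjE G (M ∩ edgeComp G U {v}ᶜ ⁻¹' {comp (adjE G U) {v}ᶜ z})) S := by
  have hSv : ∀ x ∈ S, x ∈ ({v}ᶜ : Set α) := fun x hx h => hv (h ▸ hx)
  have h1 : ∀ x ∈ S, Joined (adjE G U) {v}ᶜ z x := fun x hx =>
    hzs.trans ((hS.2 s hs x hx).mono (fun _ _ _ _ h => h.mono hMU) hSv)
  refine ⟨h1, hS.mono fun x hx y hy ⟨e, he, hl⟩ => ⟨e, ⟨he, ?_⟩, hl⟩⟩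
  exact (edgeComp_eq (hMU he) (hSv x hx) hl.inc_left).trans
    (comp_eq (adjE_symm G U) (h1 x hx)).symm

/-- Every model contains a model inside one of the parts at a given vertex. -/
theorem Theta.exists_local {M : Set β} (hMU : M ⊆ U) (h : Theta G M r A B) (hr : 1 ≤ r) {v : α}
    (hv : v ∉ B) : ∃ z, ∃ A', Theta G (M ∩ edgeComp G U {v}ᶜ ⁻¹' {comp (adjE G U) {v}ᶜ z}) r A' B := by
  obtain ⟨e₀, he₀, x₀, hx₀, z, hz, hl₀⟩ := h.exists_link hr
  set D := comp (adjE G U) {v}ᶜ z with hD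
  set M' := M ∩ edgeComp G U {v}ᶜ ⁻¹' {D} with hM'
  have hsymm := adjE_symm G U
  obtain ⟨hBD, hBc⟩ := conn_of_avoid hMU h.right hv hz (.refl z)
  have hmem : ∀ e ∈ M, ∀ y ∈ D, y ≠ v → G.Inc e y → e ∈ M' := fun e he y hy hyv hl =>
    ⟨he, (edgeComp_eq (hMU he) hyv hl).trans (comp_eq hsymm hy).symm⟩
  have hBv : ∀ y ∈ B, y ≠ v := fun y hy h => hv (h ▸ hy)
  have hstep : ∀ e ∈ M, ∀ x, ∀ y ∈ D, y ≠ v → G.IsLink e x y → x = v ∨ x ∈ D := by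
    intro e he x y hy hyv hl
    by_cases hxv : x = v
    · exact .inl hxv
    · exact .inr (Joined.trans hy (.single ⟨e, hMU he, hl.symm⟩ hyv hxv))
  -- The side `B` lies in a single component `D`. If `v ∈ A`, the set `A ∩ (D ∪ {v})` stays
  -- connected because a path in `A` can leave `D` only at `v`, and it keeps all cross edges;
  -- otherwise `A` lies in `D` as well.
  by_cases hvA : v ∈ A
  · refine ⟨z, A ∩ insert v D, h.disj.mono_left Set.inter_subset_left, ?_, hBc,
      h.le_encard.trans (Set.encard_le_encard ?_)⟩
    · refine conn_of_center (adjE_symm G M') (a := v) ⟨hvA, .inl rfl⟩ fun a ha => ?_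
      refine Joined.symm (adjE_symm G M') ?_
      by_contra hcon
      obtain ⟨u, hu, w, hw, ⟨e, he, hl⟩, huA, hwA⟩ := (h.left.2 a ha.1 v hvA).exists_exit
        (W := {x | Joined (adjE G M') (A ∩ insert v D) a x}) (.refl a) hcon
      have huA' : u ∈ A ∩ insert v D := Joined.right_mem hu ha
      have huv : u ≠ v := by
        intro h
        rw [h] at hu
        exact hcon hu
      have huD : u ∈ D := huA'.2.resolve_left huv
      refine hw (Joined.trans hu (.single ⟨e, hmem e he u huD huv hl.inc_left, hl⟩ huA'
        ⟨hwA, ?_⟩))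
      exact hstep e he w u huD huv hl.symm
    · rintro e ⟨he, x, hx, y, hy, hl⟩
      exact ⟨hmem e he y (hBD y hy) (hBv y hy) hl.inc_right, x,
        ⟨hx, hstep e he x y (hBD y hy) (hBv y hy) hl⟩, y, hy, hl⟩
  · have hx₀D : x₀ ∈ D := (hstep e₀ he₀ x₀ z (.refl z) (hBv z hz) hl₀).resolve_left
      fun h => hvA (h ▸ hx₀)
    refine ⟨z, A, h.disj, (conn_of_avoid hMU h.left hvA hx₀ hx₀D).2, hBc,
      h.le_encard.trans (Set.encard_le_encard ?_)⟩
    rintro e ⟨he, x, hx, y, hy, hl⟩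
    exact ⟨hmem e he y (hBD y hy) (hBv y hy) hl.inc_right, x, hx, y, hy, hl⟩

theorem edge_card_bound {k r n m : ℕ} (hk : 1 ≤ k) (hn : n < 2 * ((k + 1) * ((k + 1) * r)))
    (hm : m ≤ n * (2 * r * (k + 1))) : m ≤ 32 * r ^ 2 * k ^ 3 := by
  calc m ≤ n * (2 * r * (k + 1)) := hm
    _ ≤ (8 * r * k ^ 2) * (2 * r * (2 * k)) := by
      gcongr
      · exact card_bound hk hn
      · omega
    _ = 32 * r ^ 2 * k ^ 3 := by ring

/-- The free split: any model localizes to one part at `v`, and a part containing a model consists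
of edges touching a single component of the rest. -/
theorem exists_split_of_cutVertex (hr : 1 ≤ r) {k : ℕ} {v : α}
    (hv : ∀ z, z ≠ v → ¬ Packs (edgeModels G r) (touching G U (comp (adjE G U) {v}ᶜ z)) k)
    (hk : 1 ≤ k) :
    (∀ M ∈ edgeModels G r, M ⊆ U →
      ∃ i, ∃ M' ∈ edgeModels G r, M' ⊆ M ∩ edgeComp G U {v}ᶜ ⁻¹' {i}) ∧
    ∀ i, ¬ Packs (edgeModels G r) (U ∩ edgeComp G U {v}ᶜ ⁻¹' {i}) k := by
  refine ⟨?_, fun i hp => ?_⟩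
  · rintro M ⟨A, B, hAB⟩ hMU
    by_cases hvB : v ∈ B
    · obtain ⟨z, A', h⟩ := hAB.symm.exists_local hMU hr
        (fun h => Set.disjoint_left.1 hAB.disj h hvB)
      exact ⟨_, _, ⟨_, _, h⟩, subset_rfl⟩
    · obtain ⟨z, A', h⟩ := hAB.exists_local hMU hr hvB
      exact ⟨_, _, ⟨_, _, h⟩, subset_rfl⟩
  · obtain ⟨M, ⟨A, B, hAB⟩, hM⟩ := hp.exists_mem hk
    obtain ⟨e, he, x, hx, y, hy, hl⟩ := hAB.exists_link hr
    obtain ⟨z, hz, hez⟩ : ∃ z, z ≠ v ∧ G.Inc e z := by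
      by_cases hxv : x = v
      · exact ⟨y, fun h => Set.disjoint_left.1 hAB.disj hx (by rwa [hxv, ← h]), hl.inc_right⟩
      · exact ⟨x, hxv, hl.inc_left⟩
    have hi : comp (adjE G U) {v}ᶜ z = i := (edgeComp_eq (hM he).1 hz hez).symm.trans (hM he).2
    refine hv z hz (hp.mono ?_ le_rfl)
    rintro f ⟨hfU, hf⟩
    have hzf : z ∈ edgeComp G U {v}ᶜ f := by
      rw [show edgeComp G U {v}ᶜ f = i from hf, ← hi]
      exact .refl z
    obtain ⟨w, -, hfw, hwz⟩ := hzf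
    exact ⟨hfU, w, Joined.symm (adjE_symm G U) hwz, hfw⟩

/-- The bramble argument again gives a vertex set `Y`, but only edges may be removed. Without a
splitting vertex, the stars from `v ∈ Y` into a rich component `D v` are deleted, at most `2 * r *
(k + 1)` edges each. -/
theorem exists_edge_hitting (hV : G.vertexSet.Finite) (hE : G.edgeSet.Finite) (hr : 1 ≤ r) {k : ℕ}
    (hk : ¬ Packs (edgeModels G r) G.edgeSet (k + 1)) :
    ∃ X : Finset β, X.card ≤ 2 * (32 * r ^ 2) * k ^ 3 ∧
      ∀ M ∈ edgeModels G r, M ⊆ G.edgeSet → ∃ x ∈ M, x ∈ X := by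
  classical
  refine exists_hitting_of_split (ι := Set α) (q := 2) (by omega) (U₀ := G.edgeSet)
    (fun k hk1 U hU hk => ?_) subset_rfl hk
  set BB : Set (Set α) := {b | b ⊆ G.vertexSet ∧ Conn (adjE G U) b ∧
    Packs (edgeModels G r) (inner G U b) (k / 2 + 1)} with hBB
  have hinner : ∀ b, inner G U b ⊆ U := fun b e he => he.1
  have hY : ∃ Y : Finset α, Y.card < 2 * ((k + 1) * ((k + 1) * r)) ∧ ∀ b ∈ BB, ∃ x ∈ Y, x ∈ b := by
    by_contra! hcon
    obtain ⟨A, B, hAB, hd⟩ := exists_disjoint_theta hV (F := U) (BB := BB)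
      (fun b hb => hb.1) (fun b hb => hb.2.1) (fun b hb b' hb' => by
        by_contra hne
        refine hk ((hb.2.2.union hb'.2.2 (disjoint_inner ?_)).mono
          (Set.union_subset (hinner b) (hinner b')) (by omega))
        exact Set.disjoint_iff_inter_eq_empty.2 (Set.not_nonempty_iff_eq_empty.1 hne))
      (Nat.succ_pos k) hr hcon
    exact hk ⟨fun i => inner G U (A i ∪ B i), fun i => ⟨⟨A i, B i, (hAB i).inner⟩, hinner _⟩,
      fun i j hij => disjoint_inner (hd i j hij)⟩
  obtain ⟨Y, hYc, hY⟩ := hY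
  by_cases hcut : ∃ v, ∀ z, z ≠ v →
      ¬ Packs (edgeModels G r) (touching G U (comp (adjE G U) {v}ᶜ z)) (k / 2 + 1)
  · obtain ⟨v, hv⟩ := hcut
    have h := exists_split_of_cutVertex hr hv (by omega)
    exact ⟨∅, edgeComp G U {v}ᶜ, by simp, by simpa using h.1, by simpa using h.2⟩
  · push Not at hcut
    choose z hz hzp using hcut
    set D : α → Set α := fun v => comp (adjE G U) {v}ᶜ (z v) with hD
    have hfin : ∀ v, (starEdges G U v (D v)).Finite := fun v =>
      hE.subset fun e he => hU he.1
    have hstar : ∀ v, (hfin v).toFinset.card ≤ 2 * r * (k + 1) := by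
      intro v
      by_contra! hlt
      rw [← Set.ncard_eq_toFinset_card _ (hfin v)] at hlt
      exact hk (packs_of_starEdges hE hr (hz v) hlt.le)
    set X : Finset β := Y.biUnion fun v => (hfin v).toFinset with hX
    set U' : Set β := U \ X with hU'
    have hsymm' := adjE_symm G U'
    have hXc : X.card ≤ 32 * r ^ 2 * k ^ 3 :=
      edge_card_bound hk1 hYc (Finset.card_biUnion_le_card_mul _ _ _ fun v _ => hstar v)
    refine ⟨X, edgeComp G U' Set.univ, hXc, ?_, fun i hp => ?_⟩
    · rintro M ⟨A, B, hAB⟩ hM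
      obtain ⟨x, hx⟩ := (hAB.conn_union hr).1
      refine ⟨comp (adjE G U') Set.univ x, M ∩ edgeComp G U' Set.univ ⁻¹' {_},
        ⟨A, B, hAB.restrict fun e he a ha b hb hl => ⟨he, ?_⟩⟩, subset_rfl⟩
      refine (edgeComp_eq (hM he) (Set.mem_univ a) hl.inc_left).trans (comp_eq hsymm' ?_)
      exact ((hAB.conn_union hr).2 a ha x hx).mono (fun _ _ _ _ h => h.mono hM)
        (Set.subset_univ _)
    · obtain ⟨M, ⟨A, B, hAB⟩, hM⟩ := hp.exists_mem (by omega)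
      obtain ⟨e, he, x, hx, y, hy, hl⟩ := hAB.exists_link hr
      have hi : comp (adjE G U') Set.univ x = i :=
        (edgeComp_eq (hM he).1 (Set.mem_univ x) hl.inc_left).symm.trans (hM he).2
      set S : Set β := U' ∩ edgeComp G U' Set.univ ⁻¹' {i} with hS
      have hcompS : ∀ f ∈ S, ∀ w, G.Inc f w → comp (adjE G U') Set.univ w = i :=
        fun f hf w hw => (edgeComp_eq hf.1 (Set.mem_univ w) hw).symm.trans hf.2
      have hself : ∀ w, comp (adjE G U') Set.univ w = i → w ∈ i := by
        rintro w rfl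
        exact .refl w
      have hiV : i ⊆ G.vertexSet := by
        rw [← hi]
        intro w hw
        rcases Relation.ReflTransGen.cases_tail hw with h | ⟨c, -, ⟨f, -, hf⟩, -⟩
        · exact h ▸ hl.left_mem
        · exact hf.right_mem
      have hic : Conn (adjE G U) i := by
        have h : Conn (adjE G U') i := hi ▸ conn_joined hsymm' x
        exact h.mono fun _ _ _ _ h => h.mono Set.sdiff_subset
      have hSi : S ⊆ inner G U i := by
        intro f hf
        obtain ⟨a, b, hab⟩ := Graph.exists_isLink_of_mem_edgeSet (hU hf.1.1)
        exact ⟨hf.1.1, a, hself a (hcompS f hf a hab.inc_left), b,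
          hself b (hcompS f hf b hab.inc_right), hab⟩
      obtain ⟨v, hvY, hvi⟩ := hY i ⟨hiV, hic, hp.mono hSi le_rfl⟩
      -- An edge of `S` touching `D v` would connect `D v` to `v` inside `U'`; but `D v` is a
      -- component off `v`, and its edges to `v` were deleted.
      have hdisj : Disjoint S (touching G U (D v)) := by
        rw [Set.disjoint_left]
        rintro f hf ⟨-, d, hd, hfd⟩
        have hdv : Joined (adjE G U') Set.univ d v := by
          have h := hcompS f hf d hfd
          rw [← h] at hvi
          exact hvi
        have hDv : ∀ d ∈ D v, d ≠ v := fun d hd => Joined.right_mem (U := {v}ᶜ) hd (hz v)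
        obtain ⟨u, hu, w, hw, ⟨g, hg, hgl⟩, -, -⟩ :=
          hdv.exists_exit (W := D v) hd fun h => hDv v h rfl
        by_cases hwv : w = v
        · subst hwv
          refine hg.2 (Finset.mem_coe.2 (Finset.mem_biUnion.2 ⟨w, hvY, ?_⟩))
          exact (hfin w).mem_toFinset.2 ⟨hg.1, u, hu, hgl.symm⟩
        · exact hw (Joined.trans hu (.single ⟨g, hg.1, hgl⟩ (hDv u hu) hwv))
      exact hk ((hp.union (hzp v) hdisj).mono
        (Set.union_subset (fun f hf => hf.1.1) fun f hf => hf.1) (by omega))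

end EdgeVersion
-- Translation between contraction models and pairs of connected sets.
section Models

variable {α : Type u} {β : Type v} {G H : Graph α β} {F : Set β} {r : ℕ} {A B : Set α}

theorem contractEdge_isLink {e f : β} {x y p q : α} : (contractEdge H e x y).IsLink f p q ↔
    ∃ u w, H.IsLink f u w ∧ f ≠ e ∧ (open Classical in if u = y then x else u) = p ∧
      (open Classical in if w = y then x else w) = q := by
  simp only [contractEdge, Graph.map_isLink, Relation.Map, Graph.deleteEdges_isLink,
    Set.mem_singleton_iff, and_assoc]

/-- Take preimages of both sides. Two vertices with the same image are joined by `e`, so preimages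
of connected sets are connected; edges keep their names, so the cross edges are still there. -/
theorem Theta.of_contractEdge {e : β} {x y : α} (he : H.IsLink e x y) (hr : 1 ≤ r)
    (h : Theta (contractEdge H e x y) Set.univ r A B) : ∃ A' B', Theta H Set.univ r A' B' := by
  classical
  set φ : α → α := fun z => if z = y then x else z with hφ
  have hsymm := adjE_symm H (Set.univ : Set β)
  set K := contractEdge H e x y with hK
  have hlink : ∀ {f p q}, K.IsLink f p q → ∃ u w, H.IsLink f u w ∧ φ u = p ∧ φ w = q := by
    intro f p q hf
    obtain ⟨u, w, h1, -, h2, h3⟩ := contractEdge_isLink.1 hf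
    exact ⟨u, w, h1, by rw [← h2], by rw [← h3]⟩
  set pre : Set α → Set α := fun S => {z | z ∈ H.vertexSet ∧ φ z ∈ S} with hpre
  have hsame : ∀ S, ∀ p ∈ pre S, ∀ q ∈ pre S, φ p = φ q → Joined (adjE H Set.univ) (pre S) p q := by
    intro S p hp q hq hpq
    by_cases h : p = q
    · rw [h]; exact .refl _
    · refine .single ?_ hp hq
      by_cases hpy : p = y <;> by_cases hqy : q = y
      · exact absurd (hpy.trans hqy.symm) h
      · simp only [hφ, if_pos hpy, if_neg hqy] at hpq
        exact ⟨e, trivial, by rw [hpy, ← hpq]; exact he.symm⟩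
      · simp only [hφ, if_neg hpy, if_pos hqy] at hpq
        exact ⟨e, trivial, by rw [hqy, hpq]; exact he⟩
      · simp only [hφ, if_neg hpy, if_neg hqy] at hpq
        exact absurd hpq h
  have hjoin : ∀ S p q, Joined (adjE K Set.univ) S p q → ∀ p' ∈ pre S, φ p' = p →
      ∀ q' ∈ pre S, φ q' = q → Joined (adjE H Set.univ) (pre S) p' q' := by
    intro S p q hpq p' hp' hp
    induction hpq with
    | refl => exact fun q' hq' hq => hsame S p' hp' q' hq' (hp.trans hq.symm)
    | @tail m q _ hs ih =>
      intro q' hq' hq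
      obtain ⟨⟨f, -, hf⟩, hm, hqS⟩ := hs
      obtain ⟨u, w, hl, hu, hw⟩ := hlink hf
      have hu' : u ∈ pre S := ⟨hl.left_mem, hu ▸ hm⟩
      have hw' : w ∈ pre S := ⟨hl.right_mem, hw ▸ hqS⟩
      exact ((ih u hu' hu).trans (.single ⟨f, trivial, hl⟩ hu' hw')).trans
        (hsame S w hw' q' hq' (hw.trans hq.symm))
  obtain ⟨f, -, a, ha, b, hb, hf⟩ := h.exists_link hr
  obtain ⟨u, w, hl, hu, hw⟩ := hlink hf
  refine ⟨pre A, pre B, ?_, ⟨⟨u, hl.left_mem, hu ▸ ha⟩, ?_⟩, ⟨⟨w, hl.right_mem, hw ▸ hb⟩, ?_⟩,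
    h.le_encard.trans (Set.encard_le_encard ?_)⟩
  · exact Set.disjoint_left.2 fun z hz hz' => Set.disjoint_left.1 h.disj hz.2 hz'.2
  · exact fun p hp q hq => hjoin A _ _ (h.left.2 _ hp.2 _ hq.2) p hp rfl q hq rfl
  · exact fun p hp q hq => hjoin B _ _ (h.right.2 _ hp.2 _ hq.2) p hp rfl q hq rfl
  · rintro g ⟨-, a, ha, b, hb, hg⟩
    obtain ⟨u, w, hl, hu, hw⟩ := hlink hg
    exact ⟨trivial, u, ⟨hl.left_mem, hu ▸ ha⟩, w, ⟨hl.right_mem, hw ▸ hb⟩, hl⟩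

theorem theta_isLink {i : Fin r} {p q : Fin 2} : (theta r).IsLink i p q ↔ p ≠ q := by
  simp only [theta, Graph.banana_isLink, Set.mem_univ, true_and]
  revert p q
  decide

theorem theta_of_isomorphic (h : Isomorphic H (theta r)) : ∃ A B, Theta H Set.univ r A B := by
  obtain ⟨φ, ψ, h⟩ := h
  have h0 : (0 : Fin 2) ∈ (theta r).vertexSet := by simp [theta]
  have h1 : (1 : Fin 2) ∈ (theta r).vertexSet := by simp [theta]
  have hE : ∀ i, i ∈ (theta r).edgeSet := by simp [theta]
  set a := φ.symm ⟨0, h0⟩ with ha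
  set b := φ.symm ⟨1, h1⟩ with hb
  refine ⟨{(a : α)}, {(b : α)}, ?_, .singleton _, .singleton _, ?_⟩
  · rw [Set.disjoint_singleton]
    intro hab
    have := φ.symm.injective (Subtype.ext hab)
    simp at this
  · set ε : Fin r → β := fun i => ψ.symm ⟨i, hE i⟩ with hε
    have hinj : Function.Injective ε := by
      intro i j hij
      simpa using ψ.symm.injective (Subtype.ext hij)
    calc (r : ℕ∞) ≤ (Set.range ε).encard := by simpa using hinj.encard_range
      _ ≤ _ := Set.encard_le_encard (by
        rintro _ ⟨i, rfl⟩
        refine ⟨trivial, a, rfl, b, rfl, ?_⟩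
        rw [hε, h, theta_isLink]
        simp [ha, hb])

theorem exists_theta_of_isModel (hr : 1 ≤ r) (h : IsModel (theta r) H) :
    ∃ A B, Theta H Set.univ r A B := by
  obtain ⟨K, hHK, hK⟩ := h
  induction hHK using Relation.ReflTransGen.head_induction_on with
  | refl => exact theta_of_isomorphic hK
  | head hs _ ih =>
    obtain ⟨e, x, y, he, rfl⟩ := hs
    obtain ⟨A, B, h⟩ := ih
    exact h.of_contractEdge he hr

theorem Theta.of_le (hHG : H ≤ G) (h : Theta H Set.univ r A B) : Theta G H.edgeSet r A B := by
  have hadj : ∀ x y, adjE H Set.univ x y → adjE G H.edgeSet x y := fun x y ⟨e, _, he⟩ =>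
    ⟨e, he.edge_mem, he.mono hHG⟩
  refine ⟨h.disj, h.left.mono fun _ _ _ _ => hadj _ _, h.right.mono fun _ _ _ _ => hadj _ _,
    h.le_encard.trans (Set.encard_le_encard ?_)⟩
  rintro e ⟨-, x, hx, y, hy, hl⟩
  exact ⟨hl.edge_mem, x, hx, y, hy, hl.mono hHG⟩

/-- The vertices of `H` are partitioned into two connected sets joined by exactly `r` edges. -/
structure ThetaPartition (H : Graph α β) (r : ℕ) (A B : Set α) : Prop where
  vertexSet_eq : H.vertexSet = A ∪ B
  disj : Disjoint A B
  left : Conn (adjE H Set.univ) A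
  right : Conn (adjE H Set.univ) B
  encard_eq : {e | ∃ x ∈ A, ∃ y ∈ B, H.IsLink e x y}.encard = r

theorem eq_of_joined_of_forall_not {R : α → α → Prop} {x y : α} (h : Joined R A x y)
    (hA : ∀ x ∈ A, ∀ y ∈ A, ¬ R x y) : x = y := by
  rcases Relation.ReflTransGen.cases_head h with h | ⟨c, hc, -⟩
  exacts [h, absurd hc.1 (hA _ hc.2.1 _ hc.2.2)]

theorem ThetaPartition.isomorphic (h : ThetaPartition H r A B)
    (hA : ∀ x ∈ A, ∀ y ∈ A, ∀ e, ¬ H.IsLink e x y) (hB : ∀ x ∈ B, ∀ y ∈ B, ∀ e, ¬ H.IsLink e x y) :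
    Isomorphic H (theta r) := by
  classical
  obtain ⟨a, ha⟩ := h.left.1
  obtain ⟨b, hb⟩ := h.right.1
  have hAa : ∀ x ∈ A, x = a := fun x hx => eq_of_joined_of_forall_not (h.left.2 x hx a ha)
    fun x hx y hy ⟨e, _, he⟩ => hA x hx y hy e he
  have hBb : ∀ x ∈ B, x = b := fun x hx => eq_of_joined_of_forall_not (h.right.2 x hx b hb)
    fun x hx y hy ⟨e, _, he⟩ => hB x hx y hy e he
  have hV : ∀ x ∈ H.vertexSet, x = a ∨ x = b := by
    intro x hx
    rw [h.vertexSet_eq] at hx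
    exact hx.imp (hAa x) (hBb x)
  have hab : a ≠ b := fun hab => Set.disjoint_left.1 h.disj ha (hab ▸ hb)
  have haV : a ∈ H.vertexSet := h.vertexSet_eq ▸ .inl ha
  have hbV : b ∈ H.vertexSet := h.vertexSet_eq ▸ .inr hb
  have hne : ∀ e x y, H.IsLink e x y → x ≠ y := by
    rintro e x y hl rfl
    rcases hV x hl.left_mem with rfl | rfl
    exacts [hA _ ha _ ha e hl, hB _ hb _ hb e hl]
  have hE : ∀ e ∈ H.edgeSet, H.IsLink e a b := by
    intro e he
    obtain ⟨x, y, hl⟩ := Graph.exists_isLink_of_mem_edgeSet he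
    have hxy := hne e x y hl
    rcases hV x hl.left_mem with rfl | rfl <;> rcases hV y hl.right_mem with rfl | rfl
    exacts [absurd rfl hxy, hl, hl.symm, absurd rfl hxy]
  have hEeq : {e | ∃ x ∈ A, ∃ y ∈ B, H.IsLink e x y} = H.edgeSet :=
    Set.ext fun e => ⟨fun ⟨x, _, y, _, hl⟩ => hl.edge_mem, fun he => ⟨a, ha, b, hb, hE e he⟩⟩
  have hcard := h.encard_eq
  rw [hEeq] at hcard
  have hfin : H.edgeSet.Finite := Set.finite_of_encard_eq_coe hcard
  have : Fintype H.edgeSet := hfin.fintype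
  have hcard' : Fintype.card H.edgeSet = r := by
    have h1 := Set.encard_eq_coe_toFinset_card H.edgeSet
    rw [hcard, Set.toFinset_card] at h1
    exact_mod_cast h1.symm
  have hEuniv : (theta r).edgeSet = Set.univ := by simp [theta]
  have hVuniv : ∀ i, i ∈ (theta r).vertexSet := by
    intro i
    fin_cases i <;> simp [theta]
  set φ : H.vertexSet → (theta r).vertexSet := fun x => ⟨if (x : α) = a then 0 else 1, hVuniv _⟩
    with hφ
  have hφinj : Function.Injective φ := by
    rintro ⟨x, hx⟩ ⟨y, hy⟩ hxy
    rcases hV x hx with rfl | rfl <;> rcases hV y hy with rfl | rfl <;>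
      simp_all [hab.symm]
  have hφsurj : Function.Surjective φ := by
    rintro ⟨i, hi⟩
    fin_cases i
    · exact ⟨⟨a, haV⟩, by simp [hφ]⟩
    · exact ⟨⟨b, hbV⟩, by simp [hφ, hab.symm]⟩
  refine ⟨Equiv.ofBijective φ ⟨hφinj, hφsurj⟩, (Fintype.equivFinOfCardEq hcard').trans
    ((Equiv.Set.univ (Fin r)).symm.trans (Equiv.setCongr hEuniv.symm)), fun e x y => ?_⟩
  rw [theta_isLink]
  constructor
  · intro hl hxy
    exact hne _ _ _ hl (congrArg Subtype.val (hφinj (Subtype.ext hxy)))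
  · intro hxy
    have hxy' : (x : α) ≠ y := fun h => hxy (by rw [Subtype.ext h])
    have hl := hE e e.2
    rcases hV x x.2 with h1 | h1 <;> rcases hV y y.2 with h2 | h2
    · exact absurd (h1.trans h2.symm) hxy'
    · rw [h1, h2]; exact hl
    · rw [h1, h2]; exact hl.symm
    · exact absurd (h1.trans h2.symm) hxy'

/-- The contracted edge lies within one side, so the contraction map preserves both sides and no
cross edge is lost. -/
theorem ThetaPartition.contractEdge {e : β} {x y : α} (h : ThetaPartition H r A B)
    (he : H.IsLink e x y) (hxy : x ∈ A ∧ y ∈ A ∨ x ∈ B ∧ y ∈ B) :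
    ∃ A' B', ThetaPartition (contractEdge H e x y) r A' B' := by
  classical
  set φ : α → α := fun z => if z = y then x else z with hφ
  have hlink : ∀ {f p q}, (ErdosPosa.contractEdge H e x y).IsLink f p q ↔
      ∃ u w, H.IsLink f u w ∧ f ≠ e ∧ φ u = p ∧ φ w = q := by
    intro f p q
    rw [contractEdge_isLink]
  have hAφ : ∀ z ∈ A, φ z ∈ A := by
    intro z hz
    by_cases hzy : z = y
    · simp only [hφ, if_pos hzy]
      rcases hxy with h' | h'
      exacts [h'.1, absurd (hzy ▸ h'.2) (Set.disjoint_left.1 h.disj hz)]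
    · simpa only [hφ, if_neg hzy] using hz
  have hBφ : ∀ z ∈ B, φ z ∈ B := by
    intro z hz
    by_cases hzy : z = y
    · simp only [hφ, if_pos hzy]
      rcases hxy with h' | h'
      exacts [absurd hz (Set.disjoint_left.1 h.disj (hzy ▸ h'.2)), h'.1]
    · simpa only [hφ, if_neg hzy] using hz
  have hdisj : Disjoint (φ '' A) (φ '' B) := by
    refine h.disj.mono ?_ ?_
    · rintro _ ⟨z, hz, rfl⟩
      exact hAφ z hz
    · rintro _ ⟨z, hz, rfl⟩
      exact hBφ z hz
  have hφxy : φ x = φ y := by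
    simp [hφ]
  have hconn : ∀ S, Conn (adjE H Set.univ) S →
      Conn (adjE (ErdosPosa.contractEdge H e x y) Set.univ) (φ '' S) := by
    intro S hS
    have hJ : ∀ p q, Joined (adjE H Set.univ) S p q →
        Joined (adjE (ErdosPosa.contractEdge H e x y) Set.univ) (φ '' S) (φ p) (φ q) := by
      intro p q hpq
      induction hpq with
      | refl => exact .refl _
      | @tail m q _ hs ih =>
        obtain ⟨⟨f, -, hf⟩, hm, hq⟩ := hs
        refine ih.trans ?_
        by_cases hfe : f = e
        · subst hfe
          rcases hf.eq_and_eq_or_eq_and_eq he with ⟨rfl, rfl⟩ | ⟨rfl, rfl⟩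
          · rw [hφxy]; exact .refl _
          · rw [hφxy]; exact .refl _
        · exact .single ⟨f, trivial, hlink.2 ⟨m, q, hf, hfe, rfl, rfl⟩⟩ ⟨m, hm, rfl⟩ ⟨q, hq, rfl⟩
    refine ⟨hS.1.image φ, ?_⟩
    rintro _ ⟨p, hp, rfl⟩ _ ⟨q, hq, rfl⟩
    exact hJ p q (hS.2 p hp q hq)
  refine ⟨φ '' A, φ '' B, ?_, hdisj, hconn A h.left, hconn B h.right, ?_⟩
  · rw [← Set.image_union, ← h.vertexSet_eq]
    change (fun z => _) '' H.vertexSet = _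
    congr
  · rw [← h.encard_eq]
    congr 1
    ext f
    constructor
    · rintro ⟨p, hp, q, hq, hf⟩
      obtain ⟨u, w, hl, -, rfl, rfl⟩ := hlink.1 hf
      refine ⟨u, ?_, w, ?_, hl⟩
      · have hu := hl.left_mem
        rw [h.vertexSet_eq] at hu
        exact hu.resolve_right fun hu => Set.disjoint_left.1 hdisj hp ⟨u, hu, rfl⟩
      · have hw := hl.right_mem
        rw [h.vertexSet_eq] at hw
        exact hw.resolve_left fun hw => Set.disjoint_left.1 hdisj ⟨w, hw, rfl⟩ hq
    · rintro ⟨u, hu, w, hw, hl⟩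
      refine ⟨φ u, ⟨u, hu, rfl⟩, φ w, ⟨w, hw, rfl⟩, hlink.2 ⟨u, w, hl, ?_, rfl, rfl⟩⟩
      rintro rfl
      have hd := Set.disjoint_left.1 h.disj
      rcases hl.eq_and_eq_or_eq_and_eq he with ⟨rfl, rfl⟩ | ⟨rfl, rfl⟩ <;>
        rcases hxy with h' | h'
      exacts [hd h'.2 hw, hd hu h'.1, hd h'.1 hw, hd hu h'.2]

/-- Contract edges inside the sides, loops included, until none is left; a connected side without
inner edges is a single vertex. -/
theorem ThetaPartition.isModel (h : ThetaPartition H r A B) (hE : H.edgeSet.Finite) :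
    IsModel (theta r) H := by
  induction hn : H.edgeSet.ncard using Nat.strong_induction_on generalizing H A B with
  | _ n ih =>
  by_cases hex : ∃ e x y, H.IsLink e x y ∧ (x ∈ A ∧ y ∈ A ∨ x ∈ B ∧ y ∈ B)
  · obtain ⟨e, x, y, he, hxy⟩ := hex
    obtain ⟨A', B', h'⟩ := h.contractEdge he hxy
    have hEK : (ErdosPosa.contractEdge H e x y).edgeSet = H.edgeSet \ {e} := by
      simp [ErdosPosa.contractEdge]
    obtain ⟨K, hK, hiso⟩ := ih _ (by
      rw [← hn, hEK]
      exact Set.ncard_sdiff_singleton_lt_of_mem he.edge_mem hE) h'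
      (hEK ▸ hE.subset Set.sdiff_subset) rfl
    exact ⟨K, .head ⟨e, x, y, he, rfl⟩ hK, hiso⟩
  · push Not at hex
    exact ⟨H, .refl, h.isomorphic (fun x hx y hy e he => (hex e x y he).1 hx hy)
      (fun x hx y hy e he => (hex e x y he).2 hx hy)⟩

/-- Keep the edges of `F` inside either side but only `r` of the cross edges: contraction never
removes a cross edge, so a surplus would survive. -/
theorem Theta.exists_isModel (h : Theta G F r A B) (hr : 1 ≤ r) (hE : G.edgeSet.Finite) :
    ∃ H ≤ G, IsModel (theta r) H ∧ H.vertexSet = A ∪ B ∧ H.edgeSet ⊆ F := by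
  obtain ⟨R, hR, hRr⟩ := Set.exists_subset_encard_eq h.le_encard
  set S : Set β := ErdosPosa.inner G F A ∪ ErdosPosa.inner G F B ∪ R with hS
  have hSF : S ⊆ F := by
    rintro e ((he | he) | he)
    exacts [he.1, he.1, (hR he).1]
  have hV : A ∪ B ⊆ G.vertexSet := h.union_subset hr fun x y ⟨e, _, he⟩ => he.right_mem
  set H := (G.restrict S).induce (A ∪ B) with hH
  have hl : ∀ {e x y}, H.IsLink e x y ↔ (G.IsLink e x y ∧ e ∈ S) ∧ x ∈ A ∪ B ∧ y ∈ A ∪ B := by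
    intro e x y
    rw [hH, Graph.induce_isLink, Graph.restrict_isLink]
    tauto
  have hHG : H ≤ G := le_trans (Graph.induce_le (by simpa using hV)) Graph.restrict_le
  have hHS : H.edgeSet ⊆ S := by
    intro e he
    obtain ⟨x, y, he⟩ := Graph.exists_isLink_of_mem_edgeSet he
    exact (hl.1 he).1.2
  have hd := Set.disjoint_left.1 h.disj
  have hpart : ThetaPartition H r A B := by
    refine ⟨rfl, h.disj, h.left.mono ?_, h.right.mono ?_, ?_⟩
    · rintro x hx y hy ⟨e, he, hxy⟩
      exact ⟨e, trivial, hl.2 ⟨⟨hxy, .inl (.inl ⟨he, x, hx, y, hy, hxy⟩)⟩, .inl hx, .inl hy⟩⟩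
    · rintro x hx y hy ⟨e, he, hxy⟩
      exact ⟨e, trivial, hl.2 ⟨⟨hxy, .inl (.inr ⟨he, x, hx, y, hy, hxy⟩)⟩, .inr hx, .inr hy⟩⟩
    · rw [← hRr]
      congr 1
      ext e
      constructor
      · rintro ⟨x, hx, y, hy, hxy⟩
        obtain ⟨⟨hxy, (⟨-, p, hp, q, hq, hpq⟩ | ⟨-, p, hp, q, hq, hpq⟩) | he⟩, -⟩ := hl.1 hxy
        · rcases hxy.right_eq_or_eq hpq with rfl | rfl
          exacts [absurd hy (hd hp), absurd hy (hd hq)]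
        · rcases hxy.left_eq_or_eq hpq with rfl | rfl
          exacts [absurd hp (hd hx), absurd hq (hd hx)]
        · exact he
      · intro he
        obtain ⟨-, x, hx, y, hy, hxy⟩ := hR he
        exact ⟨x, hx, y, hy, hl.2 ⟨⟨hxy, .inr he⟩, .inl hx, .inr hy⟩⟩
  exact ⟨H, hHG, hpart.isModel (hE.subset (Graph.IsSubgraph.edgeSet_mono hHG)), rfl,
    hHS.trans hSF⟩

theorem exists_maximal_packing {γ : Type*} {MM : Set (Set γ)} {U : Set γ} (hU : U.Finite)
    (hne : ∀ M ∈ MM, M.Nonempty) : ∃ k, Packs MM U k ∧ ¬ Packs MM U (k + 1) := by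
  have h : ¬ Packs MM U (U.ncard + 1) := by
    rintro ⟨M, hM, hd⟩
    choose x hx using fun i => hne _ (hM i).1
    have hinj : Function.Injective x := by
      intro i j hij
      by_contra hne
      exact Set.disjoint_left.1 (hd i j hne) (hx i) (hij ▸ hx j)
    have h1 : (Set.range x).ncard ≤ U.ncard := Set.ncard_le_ncard
      (by rintro _ ⟨i, rfl⟩; exact (hM i).2 (hx i)) hU
    rw [← Set.image_univ, Set.ncard_image_of_injective _ hinj, Set.ncard_univ] at h1
    simp at h1
  obtain ⟨j, -, hj⟩ := exists_max_packs h
  exact ⟨j, hj⟩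

theorem hasVertexPacking_iff (hr : 1 ≤ r) (hE : G.edgeSet.Finite) {k : ℕ} :
    HasVertexPacking (theta r) G k ↔ Packs (vertexModels G r) G.vertexSet k := by
  constructor
  · rintro ⟨H, hH, hd⟩
    choose A B hAB using fun i => exists_theta_of_isModel hr (hH i).2
    have hsub : ∀ i, A i ∪ B i ⊆ (H i).vertexSet := fun i =>
      (hAB i).union_subset hr fun x y ⟨e, _, he⟩ => he.right_mem
    exact ⟨fun i => A i ∪ B i, fun i => ⟨⟨A i, B i, ((hAB i).of_le (hH i).1).mono
      (Set.subset_univ _), rfl⟩, (hsub i).trans (hH i).1.vertexSet_mono⟩,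
      fun i j hij => (hd i j hij).mono (hsub i) (hsub j)⟩
  · rintro ⟨M, hM, hd⟩
    choose A B hAB hMAB using fun i => (hM i).1
    choose H hHG hH hV _ using fun i => (hAB i).exists_isModel hr hE
    refine ⟨H, fun i => ⟨hHG i, hH i⟩, fun i j hij => ?_⟩
    rw [hV, hV, ← hMAB, ← hMAB]
    exact hd i j hij

theorem hasEdgePacking_iff (hr : 1 ≤ r) (hE : G.edgeSet.Finite) {k : ℕ} :
    HasEdgePacking (theta r) G k ↔ Packs (edgeModels G r) G.edgeSet k := by
  constructor
  · rintro ⟨H, hH, hd⟩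
    choose A B hAB using fun i => exists_theta_of_isModel hr (hH i).2
    exact ⟨fun i => (H i).edgeSet, fun i => ⟨⟨A i, B i, (hAB i).of_le (hH i).1⟩,
      Graph.IsSubgraph.edgeSet_mono (hH i).1⟩, hd⟩
  · rintro ⟨M, hM, hd⟩
    choose A B hAB using fun i => (hM i).1
    choose H hHG hH _ hHE using fun i => (hAB i).exists_isModel hr hE
    exact ⟨H, fun i => ⟨hHG i, hH i⟩, fun i j hij => (hd i j hij).mono (hHE i) (hHE j)⟩

theorem iSup_packs_eq {γ : Type*} {MM : Set (Set γ)} {U : Set γ} {k : ℕ} {Q : ℕ → Prop}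
    (hQ : ∀ j, Q j ↔ Packs MM U j) (hk : Packs MM U k) (hk' : ¬ Packs MM U (k + 1)) :
    (⨆ (j : ℕ) (_ : Q j), (j : ℕ∞)) = k := by
  refine le_antisymm (iSup₂_le fun j hj => ?_) (le_iSup₂_of_le k ((hQ k).2 hk) le_rfl)
  by_contra hlt
  rw [not_le, Nat.cast_lt] at hlt
  exact hk' (((hQ j).1 hj).mono subset_rfl hlt)

theorem isVertexGap_theta (hr : 1 ≤ r) :
    IsVertexGap.{u, v, 0, 0} (theta r) fun k => 2 * (8 * r) * k ^ 2 := by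
  classical
  intro α β G hV hE
  obtain ⟨k, hk, hk'⟩ := exists_maximal_packing (MM := vertexModels G r) hV (by
    rintro M ⟨A, B, hAB, rfl⟩
    exact hAB.left.1.inl)
  refine ⟨k, iSup_packs_eq (fun j => hasVertexPacking_iff hr hE) hk hk', ?_⟩
  obtain ⟨X, hX, hXM⟩ := exists_vertex_hitting hV hr hk'
  refine iInf₂_le_of_le (↑X ∩ G.vertexSet) ⟨Set.inter_subset_right, fun H hH hHM => ?_⟩ ?_
  · obtain ⟨A, B, hAB⟩ := exists_theta_of_isModel hr hHM
    have hsub : A ∪ B ⊆ H.vertexSet := hAB.union_subset hr fun x y ⟨e, _, he⟩ => he.right_mem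
    obtain ⟨x, hx, hxX⟩ := hXM _ ⟨A, B, (hAB.of_le hH).mono (Set.subset_univ _), rfl⟩
      (hsub.trans hH.vertexSet_mono)
    exact ⟨x, hsub hx, hxX, hH.vertexSet_mono (hsub hx)⟩
  · refine (Set.encard_le_encard Set.inter_subset_left).trans ?_
    rw [Set.encard_coe_eq_coe_finsetCard]
    exact_mod_cast hX

theorem isEdgeGap_theta (hr : 1 ≤ r) :
    IsEdgeGap.{u, v, 0, 0} (theta r) fun k => 2 * (32 * r ^ 2) * k ^ 3 := by
  classical
  intro α β G hV hE
  obtain ⟨k, hk, hk'⟩ := exists_maximal_packing (MM := edgeModels G r) hE (by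
    rintro M ⟨A, B, hAB⟩
    obtain ⟨e, he, -⟩ := hAB.exists_link hr
    exact ⟨e, he⟩)
  refine ⟨k, iSup_packs_eq (fun j => hasEdgePacking_iff hr hE) hk hk', ?_⟩
  obtain ⟨X, hX, hXM⟩ := exists_edge_hitting hV hE hr hk'
  refine iInf₂_le_of_le (↑X ∩ G.edgeSet) ⟨Set.inter_subset_right, fun H hH hHM => ?_⟩ ?_
  · obtain ⟨A, B, hAB⟩ := exists_theta_of_isModel hr hHM
    have hsub := Graph.IsSubgraph.edgeSet_mono hH
    obtain ⟨x, hx, hxX⟩ := hXM _ ⟨A, B, hAB.of_le hH⟩ hsub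
    exact ⟨x, hx, hxX, hsub hx⟩
  · refine (Set.encard_le_encard Set.inter_subset_left).trans ?_
    rw [Set.encard_coe_eq_coe_finsetCard]
    exact_mod_cast hX

end Models
end ErdosPosa

theorem mainTheorem4 :
    (∃ C : ℕ, ∀ r : ℕ, 1 ≤ r → ∃ f : ℕ → ℕ,
      ErdosPosa.IsVertexGap.{u, v, 0, 0} (ErdosPosa.theta r) f ∧ ∀ k : ℕ, f k ≤ C * k ^ 2 * r ^ 2) ∧
    (∃ C : ℕ, ∀ r : ℕ, 1 ≤ r → ∃ f : ℕ → ℕ,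
      ErdosPosa.IsEdgeGap.{u, v, 0, 0} (ErdosPosa.theta r) f ∧ ∀ k : ℕ, f k ≤ C * k ^ 3 * r ^ 3) := by
  -- The bounds obtained are `16 * r * k^2` and `64 * r^2 * k^3`, each better by a factor `r` than
  -- required.
  refine ⟨⟨16, fun r hr => ⟨_, ErdosPosa.isVertexGap_theta hr, fun k => ?_⟩⟩,
    ⟨64, fun r hr => ⟨_, ErdosPosa.isEdgeGap_theta hr, fun k => ?_⟩⟩⟩
  · calc 2 * (8 * r) * k ^ 2 = 16 * k ^ 2 * r := by ring
      _ ≤ 16 * k ^ 2 * r ^ 2 := Nat.mul_le_mul_left _ (Nat.le_self_pow (by omega) r)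
  · calc 2 * (32 * r ^ 2) * k ^ 3 = 64 * k ^ 3 * r ^ 2 := by ring
      _ ≤ 64 * k ^ 3 * r ^ 3 := Nat.mul_le_mul_left _ (Nat.pow_le_pow_right hr (by omega))
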